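/- **Conventions.** A strongly regular sequence is a sequence $\mathbb{M}=(M_p)_{p\ge0}$ of positive reals with $M_0=1$ such that: $M_p^2\le M_{p-1}M_{p+1}$ for $p\ge1$; there is $A>0$ with $M_{p+q}\le A^{p+q}M_pM_q$ for all $p,q\ge0$; and there is $B>0$ with $\sum_{q\ge p}\frac{M_q}{(q+1)M_{q+1}}\le B\frac{M_p}{M_{p+1}}$ for all $p\ge0$. Put $h_{\mathbb{M}}(t)=\inf_{p\ge0}M_pt^p$ and $\omega(\mathbb{M})=\lim_{r\to\infty}\frac{\log r}{\log^+(-\log h_{\mathbb{M}}(1/r))}$ (lower limit if the limit does not exist). All sectors are open sectors in $\mathbb{C}$ with vertex at $0$, of opening at most $2\pi$; a proper subsector of $S$ is a bounded sector $T$ with $\overline{T}\setminus\{0\}\subseteq S$. Let $\mathbb{E}$ be a complex Banach space. A holomorphic $f:S\to\mathbb{E}$ has $\hat f=\sum_p a_pz^p\in\mathbb{E}[[z]]$ as its $\mathbb{M}$-asymptotic expansion in $S$ if for each proper subsector $T$ of $S$ there are $C,A>0$ with $\|f(z)-\sum_{p<n}a_pz^p\|\le CA^nM_n|z|^n$ for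 all $n\ge1$, $z\in T$. A $1/\alpha$-Gevrey expansion is the case $M_p=(p!)^{1/\alpha}$. A good covering consists of $\nu$ sectors $\mathcal{E}_i=\{0<|\epsilon|<r,\ a_i<\arg\epsilon<b_i\}$ of common radius $r>0$, numbered counterclockwise and going around the origin once; that is, with indices extended to $\mathbb{Z}$ by $a_{i+\nu}=a_i+2\pi$, $b_{i+\nu}=b_i+2\pi$, one has $a_i\le a_{i+1}<b_i\le b_{i+1}$ and $b_i-a_i\le2\pi$. Consequently $\mathcal{E}_i\cap\mathcal{E}_{i+1}\ne\emptyset$ and $\bigcup_i\mathcal{E}_i=\{0<|\epsilon|<r\}$. Indices of the $\mathcal{E}_i$ are read modulo $\nu$. Let $\kappa>0$ with $\omega(\mathbb{M})<1/\kappa$ and let $\mathcal{E}$ be a bounded sector of opening larger than $\pi\omega(\mathbb{M})$. A series $\hat f\in\mathbb{E}[[\epsilon]]$ is $(\mathbb{M},\kappa)$-summable on $\mathcal{E}$ with sum $f$ if $\hat f=\hat f_1+\hat f_2$ and $f=f_1+f_2$ on $\mathcal{E}$, where $f_2$ is holomorphic on $\mathcal{E}$ with $\mathbb{M}$-asymptotic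 expansion $\hat f_2$ there, and $f_1$ is holomorphic on some bounded sector $\mathcal{F}\supseteq\mathcal{E}$ of opening larger than $\pi/\kappa$, with $1/\kappa$-Gevrey asymptotic expansion $\hat f_1$ on $\mathcal{F}$. **Theorem (RS).** Let $(\mathcal{E}_i)_{0\le i\le\nu-1}$ be a good covering and $\mathbb{M}$ a strongly regular sequence. Let $G_i:\mathcal{E}_i\to\mathbb{E}$ be holomorphic and bounded as $\epsilon\to0$ in $\mathcal{E}_i$, for every $i$, and put $\Delta_i=G_{i+1}-G_i$ on $Z_i=\mathcal{E}_i\cap\mathcal{E}_{i+1}$. Let $\alpha>0$, and let $\{0,\dots,\nu-1\}$ be the disjoint union of nonempty sets $I_1,I_2$ such that for every $i\in I_1$ there are $K_1,M_1>0$ with $\|\Delta_i(\epsilon)\|\le K_1e^{-M_1/|\epsilon|^\alpha}$ on $Z_i$, and for every $i\in I_2$ there are $K_2,M_2>0$ with $\|\Delta_i(\epsilon)\|\le K_2h_{\mathbb{M}}(M_2|\epsilon|)$ on $Z_i$. Then there are a power series $\hat a$ with coefficients in $\mathbb{E}$, convergent on $|\epsilon|<r$ with sum $a$, formal series $\hat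 G^1,\hat G^2\in\mathbb{E}[[\epsilon]]$, and holomorphic functions $G_i^1,G_i^2:\mathcal{E}_i\to\mathbb{E}$ such that for every $0\le i\le\nu-1$ $$G_i=a+G_i^1+G_i^2\quad\text{on }\mathcal{E}_i,$$ $G_i^1$ has $\hat G^1$ as its $1/\alpha$-Gevrey asymptotic expansion on $\mathcal{E}_i$, and $G_i^2$ has $\hat G^2$ as its $\mathbb{M}$-asymptotic expansion on $\mathcal{E}_i$. Moreover, these can be chosen so that the following holds. Suppose $\omega(\mathbb{M})<1/\alpha$, and let $i_0$ and integers $\delta_1,\delta_2\ge0$ be such that the opening of $\mathcal{E}_{i_0}$ is larger than $\pi\omega(\mathbb{M})$, all of $i_0-\delta_1,\dots,i_0+\delta_2$ (modulo $\nu$) lie in $I_2$, and for some sector $S_{\pi/\alpha}$ of radius $r$ with opening larger than $\pi/\alpha$ one has $$\mathcal{E}_{i_0}\subset S_{\pi/\alpha}\subset\bigcup_{i_0-\delta_1\le h\le i_0+\delta_2}\mathcal{E}_h,$$ the inclusions being understood for the intervals of arguments: $(a_{i_0},b_{i_0})\subset(s,t)\subset\bigcup_h(a_h,b_h)$ if $S_{\pi/\alpha}$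 has arguments in $(s,t)$. Then $\hat G=\hat a+\hat G^1+\hat G^2$ is $(\mathbb{M},\alpha)$-summable on $\mathcal{E}_{i_0}$ with sum $G_{i_0}$. -/

import Mathlib

open Set Filter Topology
open scoped Nat

noncomputable section

namespace RamisSibuya

/-- The open sector with vertex at the origin, radius `r` and arguments in `(a, b)`. It is used with
`a < b ≤ a + 2π` and `0 < r`; its opening is then `b - a`. -/
def sector (a b r : ℝ) : Set ℂ :=
  {z | ∃ ρ θ : ℝ, 0 < ρ ∧ ρ < r ∧ a < θ ∧ θ < b ∧ z = ρ * Complex.exp (θ * Complex.I)}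

/-- A good covering of `ℂ \ {0}` by `ν` open sectors of common radius, in counterclockwise order,
winding once around the origin. Indices run over `ℤ` and are to be read modulo `ν`:
the arguments of the `i`-th sector fill the interval `(lower i, upper i)`,
and increasing the index by `ν` adds `2π`. -/
structure GoodCovering (ν : ℕ) where
  lower : ℤ → ℝ
  upper : ℤ → ℝ
  radius : ℝ
  radius_pos : 0 < radius
  lower_lt_upper : ∀ i, lower i < upper i
  upper_le : ∀ i, upper i ≤ lower i + 2 * Real.pi
  lower_add_period : ∀ i, lower (i + ν) = lower i + 2 * Real.pi
  upper_add_period : ∀ i, upper (i + ν) = upper i + 2 * Real.pi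
  lower_mono : Monotone lower
  upper_mono : Monotone upper
  overlap : ∀ i, lower (i + 1) < upper i

namespace GoodCovering

variable {ν : ℕ}

/-- The sectors `𝓔 i` of the covering. -/
def 𝓔 (𝒞 : GoodCovering ν) (i : ℤ) : Set ℂ :=
  sector (𝒞.lower i) (𝒞.upper i) 𝒞.radius

end GoodCovering

lemma sector_add_two_pi (a b r : ℝ) :
    sector (a + 2 * Real.pi) (b + 2 * Real.pi) r = sector a b r := by
  ext z
  constructor
  · rintro ⟨ρ, θ, h1, h2, h3, h4, rfl⟩
    refine ⟨ρ, θ - 2 * Real.pi, h1, h2, by linarith, by linarith, ?_⟩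
    congr 1
    rw [← Complex.exp_periodic (((θ - 2 * Real.pi : ℝ) : ℂ) * Complex.I)]
    congr 1
    push_cast
    ring
  · rintro ⟨ρ, θ, h1, h2, h3, h4, rfl⟩
    refine ⟨ρ, θ + 2 * Real.pi, h1, h2, by linarith, by linarith, ?_⟩
    congr 1
    rw [← Complex.exp_periodic ((θ : ℂ) * Complex.I)]
    congr 1
    push_cast
    ring

/-- The sectors depend only on the index modulo `ν`. -/
lemma GoodCovering.sector_periodic {ν : ℕ} (𝒞 : GoodCovering ν) (i : ℤ) :
    𝒞.𝓔 (i + ν) = 𝒞.𝓔 i := by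
  simp only [GoodCovering.𝓔, 𝒞.lower_add_period, 𝒞.upper_add_period, sector_add_two_pi]

/-- Consecutive sectors intersect. -/
lemma GoodCovering.inter_nonempty {ν : ℕ} (𝒞 : GoodCovering ν) (i : ℤ) :
    (𝒞.𝓔 i ∩ 𝒞.𝓔 (i + 1)).Nonempty := by
  obtain ⟨θ, h1, h2⟩ := exists_between (𝒞.overlap i)
  have hr := 𝒞.radius_pos
  have hl := 𝒞.lower_mono (show i ≤ i + 1 by lia)
  have hu := 𝒞.upper_mono (show i ≤ i + 1 by lia)
  exact ⟨((𝒞.radius / 2 : ℝ) : ℂ) * Complex.exp (θ * Complex.I),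
    ⟨_, θ, by linarith, by linarith, by linarith, by linarith, rfl⟩,
    ⟨_, θ, by linarith, by linarith, by linarith, by linarith, rfl⟩⟩

/-- The sectors cover a punctured disc. -/
lemma GoodCovering.iUnion_eq {ν : ℕ} (𝒞 : GoodCovering ν) :
    ⋃ i, 𝒞.𝓔 i = Metric.ball (0 : ℂ) 𝒞.radius \ {0} := by
  ext z
  simp only [mem_iUnion, Set.mem_sdiff, Metric.mem_ball, dist_zero_right, mem_singleton_iff]
  constructor
  · rintro ⟨i, ρ, θ, h1, h2, -, -, rfl⟩
    refine ⟨?_, ?_⟩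
    · rw [norm_mul, Complex.norm_exp_ofReal_mul_I, mul_one, Complex.norm_real, Real.norm_eq_abs,
        abs_of_pos h1]
      exact h2
    · exact mul_ne_zero (by exact_mod_cast h1.ne') (Complex.exp_ne_zero _)
  · rintro ⟨h1, h2⟩
    have hpi := Real.pi_pos
    have hmul : ∀ n : ℕ, 𝒞.lower (n * ν) = 𝒞.lower 0 + n * (2 * Real.pi) := by
      intro n
      induction n with
      | zero => simp
      | succ n ih =>
        have h := 𝒞.lower_add_period (n * ν)
        rw [ih] at h
        push_cast
        rw [show ((n : ℤ) + 1) * ν = n * ν + ν by ring, h]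
        ring
    have hmul' : ∀ n : ℕ, 𝒞.lower (-(n * ν)) = 𝒞.lower 0 - n * (2 * Real.pi) := by
      intro n
      induction n with
      | zero => simp
      | succ n ih =>
        have h := 𝒞.lower_add_period (-((n + 1) * ν))
        rw [show -(((n : ℤ) + 1) * ν) + ν = -(n * ν) by ring, ih] at h
        push_cast
        linarith
    obtain ⟨n, hn⟩ := exists_nat_gt ((Complex.arg z - 𝒞.lower 0) / (2 * Real.pi))
    obtain ⟨m, hm⟩ := exists_nat_gt ((𝒞.lower 0 - Complex.arg z) / (2 * Real.pi))
    rw [div_lt_iff₀ (by positivity)] at hn hm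
    obtain ⟨i, hi, hmax⟩ := Int.exists_greatest_of_bdd
      (P := fun i : ℤ => 𝒞.lower i < Complex.arg z)
      ⟨n * ν, fun j hj => by
        by_contra hc
        have h1 := 𝒞.lower_mono (le_of_lt (not_le.mp hc))
        rw [hmul n] at h1
        linarith⟩
      ⟨-(m * ν), by
        show 𝒞.lower (-(m * ν)) < Complex.arg z
        rw [hmul' m]
        linarith⟩
    have hi' : Complex.arg z ≤ 𝒞.lower (i + 1) := by
      by_contra hc
      have := hmax (i + 1) (not_le.mp hc)
      lia
    exact ⟨i, ‖z‖, Complex.arg z, norm_pos_iff.mpr h2, h1, hi, hi'.trans_lt (𝒞.overlap i),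
      (Complex.norm_mul_exp_arg_mul_I z).symm⟩

/-- Strongly regular sequences: positive, `M 0 = 1`, logarithmically convex, of moderate growth,
and strongly non-quasianalytic. -/
structure StronglyRegular (M : ℕ → ℝ) : Prop where
  pos : ∀ p, 0 < M p
  zero_eq_one : M 0 = 1
  log_convex : ∀ p, M (p + 1) ^ 2 ≤ M p * M (p + 2)
  moderate_growth : ∃ A : ℝ, 0 < A ∧ ∀ p q, M (p + q) ≤ A ^ (p + q) * M p * M q
  strong_nonquasianalytic : ∃ B : ℝ, 0 < B ∧ ∀ p : ℕ,
    Summable (fun k : ℕ => M (p + k) / (((p + k : ℕ) + 1 : ℝ) * M (p + k + 1))) ∧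
    ∑' k : ℕ, M (p + k) / (((p + k : ℕ) + 1 : ℝ) * M (p + k + 1)) ≤ B * (M p / M (p + 1))

/-- The function `h_𝕄(t) = inf_p M_p t^p`, for `t ≥ 0`. -/
def hFun (M : ℕ → ℝ) (t : ℝ) : ℝ := ⨅ p : ℕ, M p * t ^ p

/-- `ω(𝕄)`, the limit of `log r / log⁺ (-log h_𝕄(1/r))` as `r → ∞` (taken as the lower limit,
which is the limit whenever the latter exists). -/
def omega (M : ℕ → ℝ) : ℝ :=
  liminf (fun r : ℝ => Real.log r / max 0 (Real.log (-Real.log (hFun M (1 / r))))) atTop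

/-- The Gevrey sequence `(p!^{1/κ})_p`. -/
def gevrey (κ : ℝ) (p : ℕ) : ℝ := ((p ! : ℕ) : ℝ) ^ (1 / κ)

variable {F : Type*} [NormedAddCommGroup F] [NormedSpace ℂ F]

/-- `f` is holomorphic on `S` and admits the formal power series `∑ c_p z^p` as its
`𝕄`-asymptotic expansion in `S`. Proper subsectors `T` of `S` are the bounded sectors with
`closure T \ {0} ⊆ S`. -/
def HasAsymptoticExpansion (M : ℕ → ℝ) (f : ℂ → F) (c : ℕ → F) (S : Set ℂ) : Prop :=
  DifferentiableOn ℂ f S ∧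
  ∀ a b r : ℝ, a < b → b ≤ a + 2 * Real.pi → 0 < r → closure (sector a b r) \ {0} ⊆ S →
    ∃ C A : ℝ, 0 < C ∧ 0 < A ∧ ∀ n : ℕ, 1 ≤ n → ∀ z ∈ sector a b r,
      ‖f z - ∑ p ∈ Finset.range n, z ^ p • c p‖ ≤ C * A ^ n * M n * ‖z‖ ^ n

/-- The formal series `c` is `𝕄`-summable on the sector `sector a b r`, with `𝕄`-sum `f`. -/
def IsSumOn (M : ℕ → ℝ) (a b r : ℝ) (c : ℕ → F) (f : ℂ → F) : Prop :=
  omega M * Real.pi < b - a ∧ HasAsymptoticExpansion M f c (sector a b r)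

/-- The formal series `c` is (Gevrey) `κ`-summable on `sector a b r`, with `κ`-sum `f`. -/
def IsGevreySumOn (κ : ℝ) (a b r : ℝ) (c : ℕ → F) (f : ℂ → F) : Prop :=
  Real.pi / κ < b - a ∧ HasAsymptoticExpansion (gevrey κ) f c (sector a b r)

/-- The formal series `c` is `(𝕄, κ)`-summable on `sector a b r`, with `(𝕄, κ)`-sum `f`: one has
`c = c₁ + c₂` and `f = f₁ + f₂`, where `f₂` is the `𝕄`-sum of `c₂` on the given sector and
`f₁` is the `κ`-sum of `c₁` on some bounded sector which contains the given one. -/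
def IsMultiSumOn (M : ℕ → ℝ) (κ : ℝ) (a b r : ℝ) (c : ℕ → F) (f : ℂ → F) : Prop :=
  omega M < 1 / κ ∧
  ∃ s t ρ : ℝ, s < t ∧ t ≤ s + 2 * Real.pi ∧ 0 < ρ ∧ sector a b r ⊆ sector s t ρ ∧
    ∃ (c₁ c₂ : ℕ → F) (f₁ f₂ : ℂ → F),
      (∀ n, c n = c₁ n + c₂ n) ∧
      IsGevreySumOn κ s t ρ c₁ f₁ ∧
      IsSumOn M a b r c₂ f₂ ∧
      ∀ z ∈ sector a b r, f z = f₁ z + f₂ z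

end RamisSibuya

end

/-! The jumps `Δ_i` are written as coboundaries by means of Cauchy–Heine integrals. Put `ε = exp w`:
sectors become half-strips `Re w < L`, `a < Im w < b`, and the covering, indexed by `ℤ`, unrolls
along the imaginary direction. The Cauchy kernel `dζ / (ζ - ε)` becomes `dz / (1 - exp (w - z))`,
which is `2πi`-periodic in `w`. A finite geometric sum splits this kernel into the terms `exp (p (w
- z))`, `p < n`, and the remainder `exp (n (w - z)) / (1 - exp (w - z))`. If `D` is flat, that is
`‖D z‖ ≤ C A^n m_n exp ((n + 1) Re z)` for all `n`, then the integral of `D` against the kernel has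
the moments of `D` as coefficients and a remainder `O(A^n m_n exp (n Re w))`, wherever `1 - exp (w -
z)` stays away from `0` on the path. The spare factor `exp (Re z)` in the definition of flatness
makes all these integrals converge at `-∞`.

The integral along a ray jumps by `D` across that ray. Bending the initial part of the path to
another ray in the domain of `D` continues the integral analytically across the first ray, and by
Cauchy's theorem leaves the moments unchanged. So a flat `D` on `a < Im w < b` equals `Ψ w - Ψ (w +
2πi)`, where `Ψ` lives on `a < Im w < b + 2π` and has an expansion that is uniform up to the lateral
sides (`exists_sub_add_period_eq`). For a cocycle `D_k`, the sum `H_k = Ψ_{k-1} + ... + Ψ_{k-ν}`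
telescopes to `H_{k+1} - H_k = D_k`, and its coefficients do not depend on `k` (`exists_splitting`).

This is applied separately to the jumps with index in `I₁` (Gevrey bounds) and to those with index
in `I₂` (`M`-bounds), which gives `H₁` and `H₂`. The difference `G - H₁ - H₂` has no jumps and is
bounded near `0`, hence extends to a holomorphic function on the disc, the convergent part
(`exists_decomposition`). For the summability statement, `H₁` has no jump at the indices of `I₂`, so
its branches glue over the wide sector to one function with the same Gevrey expansion
(`exists_glue`). This function plus the convergent part is the Gevrey summand, and `H₂` is the
`M`-summand. -/

namespace RamisSibuya

variable {E : Type*} [NormedAddCommGroup E] [NormedSpace ℂ E]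

/-! ### Uniform expansions and flatness in the logarithmic coordinate -/

/-- The strip which the exponential maps to a sector of radius `exp L`. -/
def logStrip (a b L : ℝ) : Set ℂ := {w | w.re < L ∧ a < w.im ∧ w.im < b}

lemma isOpen_logStrip (a b L : ℝ) : IsOpen (logStrip a b L) :=
  (isOpen_lt Complex.continuous_re continuous_const).inter
    ((isOpen_lt continuous_const Complex.continuous_im).inter
      (isOpen_lt Complex.continuous_im continuous_const))

/-- `f` has the expansion `∑ a_p exp (p w)` with `m`-bounds, uniformly on `W`. -/
def UnifExp (m : ℕ → ℝ) (a : ℕ → E) (f : ℂ → E) (W : Set ℂ) : Prop :=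
  ∃ C A : ℝ, 0 < C ∧ 0 < A ∧ ∀ n : ℕ, ∀ w ∈ W,
    ‖f w - ∑ p ∈ Finset.range n, Complex.exp (p * w) • a p‖ ≤
      C * A ^ n * m n * Real.exp (n * w.re)

/-- `D` is `m`-flat on `W`. -/
def IsFlat (m : ℕ → ℝ) (D : ℂ → E) (W : Set ℂ) : Prop :=
  ∃ C A : ℝ, 0 < C ∧ 0 < A ∧ ∀ n : ℕ, ∀ w ∈ W,
    ‖D w‖ ≤ C * A ^ n * m n * Real.exp (n * w.re) * Real.exp w.re

lemma const_mul_pow_le_of_le {m : ℕ → ℝ} (hm : ∀ n, 0 ≤ m n) {C A C' A' : ℝ} (hC : 0 ≤ C)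
    (hA : 0 ≤ A) (hC' : C ≤ C') (hA' : A ≤ A') (n : ℕ) (x : ℝ) :
    C * A ^ n * m n * Real.exp x ≤ C' * A' ^ n * m n * Real.exp x := by
  have := hm n
  gcongr
  exact hC.trans hC'

namespace UnifExp

variable {m : ℕ → ℝ} {a b : ℕ → E} {f g : ℂ → E} {W W' : Set ℂ}

lemma mono (h : UnifExp m a f W) (hW : W' ⊆ W) : UnifExp m a f W' := by
  obtain ⟨C, A, hC, hA, h⟩ := h
  exact ⟨C, A, hC, hA, fun n w hw => h n w (hW hw)⟩

lemma congr (h : UnifExp m a f W) (hfg : ∀ w ∈ W, g w = f w) : UnifExp m a g W := by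
  obtain ⟨C, A, hC, hA, h⟩ := h
  exact ⟨C, A, hC, hA, fun n w hw => by rw [hfg w hw]; exact h n w hw⟩

lemma union (hm : ∀ n, 0 ≤ m n) (h : UnifExp m a f W) (h' : UnifExp m a f W') :
    UnifExp m a f (W ∪ W') := by
  obtain ⟨C, A, hC, hA, h⟩ := h
  obtain ⟨C', A', hC', hA', h'⟩ := h'
  refine ⟨max C C', max A A', lt_max_of_lt_left hC, lt_max_of_lt_left hA, fun n w hw => ?_⟩
  rcases hw with hw | hw
  · exact (h n w hw).trans (const_mul_pow_le_of_le hm hC.le hA.le (le_max_left _ _)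
      (le_max_left _ _) _ _)
  · exact (h' n w hw).trans (const_mul_pow_le_of_le hm hC'.le hA'.le (le_max_right _ _)
      (le_max_right _ _) _ _)

lemma empty : UnifExp m a f ∅ := ⟨1, 1, one_pos, one_pos, fun _ _ hw => hw.elim⟩

lemma biUnion {ι : Type*} (hm : ∀ n, 0 ≤ m n) (s : Finset ι) {V : ι → Set ℂ}
    (h : ∀ i ∈ s, UnifExp m a f (V i)) : UnifExp m a f (⋃ i ∈ s, V i) := by
  classical
  induction s using Finset.induction_on with
  | empty => simpa using empty
  | insert i s _ ih =>
    rw [Finset.set_biUnion_insert]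
    exact (h i (Finset.mem_insert_self _ _)).union hm
      (ih fun j hj => h j (Finset.mem_insert_of_mem hj))

lemma add (hm : ∀ n, 0 ≤ m n) (h : UnifExp m a f W) (h' : UnifExp m b g W) :
    UnifExp m (fun p => a p + b p) (fun w => f w + g w) W := by
  obtain ⟨C, A, hC, hA, h⟩ := h
  obtain ⟨C', A', hC', hA', h'⟩ := h'
  refine ⟨C + C', max A A', by positivity, lt_max_of_lt_left hA, fun n w hw => ?_⟩
  have e : f w + g w - ∑ p ∈ Finset.range n, Complex.exp (p * w) • (a p + b p) =
      (f w - ∑ p ∈ Finset.range n, Complex.exp (p * w) • a p) +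
      (g w - ∑ p ∈ Finset.range n, Complex.exp (p * w) • b p) := by
    simp only [smul_add, Finset.sum_add_distrib]
    abel
  rw [e]
  refine (norm_add_le _ _).trans ?_
  have h1 := (h n w hw).trans (const_mul_pow_le_of_le hm hC.le hA.le le_rfl
    (le_max_left A A') n _)
  have h2 := (h' n w hw).trans (const_mul_pow_le_of_le hm hC'.le hA'.le le_rfl
    (le_max_right A A') n _)
  calc _ ≤ _ := add_le_add h1 h2
    _ = _ := by ring

lemma const_smul (hm : ∀ n, 0 ≤ m n) (c : ℂ) (h : UnifExp m a f W) :
    UnifExp m (fun p => c • a p) (fun w => c • f w) W := by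
  obtain ⟨C, A, hC, hA, h⟩ := h
  refine ⟨(‖c‖ + 1) * C, A, by positivity, hA, fun n w hw => ?_⟩
  have e : c • f w - ∑ p ∈ Finset.range n, Complex.exp (p * w) • c • a p =
      c • (f w - ∑ p ∈ Finset.range n, Complex.exp (p * w) • a p) := by
    simp only [smul_sub, Finset.smul_sum]
    congr 1
    exact Finset.sum_congr rfl fun p _ => smul_comm _ _ _
  rw [e, norm_smul]
  have := hm n
  calc ‖c‖ * _ ≤ (‖c‖ + 1) * (C * A ^ n * m n * Real.exp (n * w.re)) := by
        gcongr
        · linarith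
        · exact h n w hw
    _ = _ := by ring

lemma finset_sum {ι : Type*} (hm : ∀ n, 0 ≤ m n) (s : Finset ι) {a : ι → ℕ → E} {f : ι → ℂ → E}
    (h : ∀ i ∈ s, UnifExp m (a i) (f i) W) :
    UnifExp m (fun p => ∑ i ∈ s, a i p) (fun w => ∑ i ∈ s, f i w) W := by
  classical
  induction s using Finset.induction_on with
  | empty =>
    refine ⟨1, 1, one_pos, one_pos, fun n w _ => ?_⟩
    have := hm n
    simp only [Finset.sum_empty, smul_zero, Finset.sum_const_zero, sub_zero, norm_zero]
    positivity
  | insert i s hi ih =>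
    simp only [Finset.sum_insert hi]
    exact (h i (Finset.mem_insert_self _ _)).add hm
      (ih fun j hj => h j (Finset.mem_insert_of_mem hj))

/-- Expansions only see `exp w`. -/
lemma comp_add (h : UnifExp m a f W) (q : ℤ) :
    UnifExp m a (fun w => f (w + q * (2 * Real.pi * Complex.I)))
      {w | w + q * (2 * Real.pi * Complex.I) ∈ W} := by
  obtain ⟨C, A, hC, hA, h⟩ := h
  refine ⟨C, A, hC, hA, fun n w hw => ?_⟩
  have h1 := h n _ hw
  have e : ∀ p : ℕ, Complex.exp (p * (w + q * (2 * Real.pi * Complex.I))) =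
      Complex.exp (p * w) := fun p => by
    rw [Complex.exp_eq_exp_iff_exists_int]
    exact ⟨p * q, by push_cast; ring⟩
  simpa [e] using h1

end UnifExp

lemma IsFlat.unifExp {m : ℕ → ℝ} {D : ℂ → E} {W : Set ℂ} (h : IsFlat m D W) (hm : ∀ n, 0 ≤ m n)
    {L : ℝ} (hL : ∀ w ∈ W, w.re ≤ L) : UnifExp m (fun _ => 0) D W := by
  obtain ⟨C, A, hC, hA, h⟩ := h
  refine ⟨C * Real.exp L, A, by positivity, hA, fun n w hw => ?_⟩
  simp only [smul_zero, Finset.sum_const_zero, sub_zero]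
  have := hm n
  calc _ ≤ _ := h n w hw
    _ ≤ C * A ^ n * m n * Real.exp (n * w.re) * Real.exp L := by
      gcongr
      exact hL w hw
    _ = _ := by ring

/-! ### Cauchy transforms of flat functions along paths -/

/-- The Cauchy transform of `D` along the path `z` restricted to `J`, in logarithmic coordinates. -/
noncomputable def cauchyTransform (J : Set ℝ) (z : ℝ → ℂ) (D : ℂ → E) (w : ℂ) : E :=
  ∫ t in J, (1 - Complex.exp (w - z t))⁻¹ • D (z t)

/-- The moments of `D` along the path `z` restricted to `J`. -/
noncomputable def moment (J : Set ℝ) (z : ℝ → ℂ) (D : ℂ → E) (p : ℕ) : E :=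
  ∫ t in J, Complex.exp (-(p * z t)) • D (z t)

/-- A path in `S` along which `exp` is integrable. -/
structure IsPath (J : Set ℝ) (z : ℝ → ℂ) (S : Set ℂ) : Prop where
  measurableSet : MeasurableSet J
  continuous : Continuous z
  mapsTo : MapsTo z J S
  integrableOn : MeasureTheory.IntegrableOn (fun t => Real.exp (z t).re) J

namespace IsPath

variable {J : Set ℝ} {z : ℝ → ℂ} {S : Set ℂ} {D : ℂ → E} {m : ℕ → ℝ}

omit [NormedSpace ℂ E] in
lemma aestronglyMeasurable (h : IsPath J z S) (hD : ContinuousOn D S) :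
    MeasureTheory.AEStronglyMeasurable (fun t => D (z t)) (MeasureTheory.volume.restrict J) :=
  (hD.comp h.continuous.continuousOn h.mapsTo).aestronglyMeasurable h.measurableSet

/-- Flatness of order `n` compensates a factor growing like `exp (-n Re z)` and leaves the
integrable `exp (Re z)`. It serves with `n = p` for the moments and with `n = 0` for the Cauchy
kernel. -/
lemma integrable_smul (h : IsPath J z S) (hD : ContinuousOn D S) (hflat : IsFlat m D S)
    {k : ℝ → ℂ} (hk : MeasureTheory.AEStronglyMeasurable k (MeasureTheory.volume.restrict J))
    (n : ℕ) {B : ℝ} (hB : ∀ t ∈ J, ‖k t‖ ≤ B * Real.exp (-(n * (z t).re))) :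
    MeasureTheory.IntegrableOn (fun t => k t • D (z t)) J := by
  obtain ⟨C, A, hC, hA, hflat⟩ := hflat
  refine (h.integrableOn.const_mul (B * (C * A ^ n * m n))).mono'
    (hk.smul (h.aestronglyMeasurable hD)) ?_
  refine (MeasureTheory.ae_restrict_iff' h.measurableSet).2 (Eventually.of_forall fun t ht => ?_)
  rw [norm_smul]
  calc ‖k t‖ * ‖D (z t)‖ ≤ (B * Real.exp (-(n * (z t).re))) *
        (C * A ^ n * m n * Real.exp (n * (z t).re) * Real.exp (z t).re) := by
        gcongr
        · exact (norm_nonneg _).trans (hB t ht)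
        · exact hB t ht
        · exact hflat n _ (h.mapsTo ht)
    _ = B * (C * A ^ n * m n) * Real.exp (z t).re *
          (Real.exp (-(n * (z t).re)) * Real.exp (n * (z t).re)) := by ring
    _ = _ := by rw [← Real.exp_add]; simp

lemma integrable (h : IsPath J z S) (hD : ContinuousOn D S) (hflat : IsFlat m D S) :
    MeasureTheory.IntegrableOn (fun t => D (z t)) J := by
  have := h.integrable_smul hD hflat (k := fun _ => 1)
    MeasureTheory.aestronglyMeasurable_const 0 (B := 1) (fun t _ => by simp)
  simpa using this

lemma integrable_moment (h : IsPath J z S) (hD : ContinuousOn D S) (hflat : IsFlat m D S)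
    (p : ℕ) : MeasureTheory.IntegrableOn (fun t => Complex.exp (-(p * z t)) • D (z t)) J := by
  have hz := h.continuous
  refine h.integrable_smul hD hflat (Continuous.aestronglyMeasurable (by fun_prop)) p (B := 1)
    fun t _ => ?_
  rw [Complex.norm_exp]
  simp

lemma measurable_kernel (h : IsPath J z S) (w : ℂ) :
    Measurable fun t => (1 - Complex.exp (w - z t))⁻¹ := by
  have := h.continuous
  exact (Continuous.measurable (by fun_prop)).inv

lemma integrable_cauchyTransform (h : IsPath J z S) (hD : ContinuousOn D S)
    (hflat : IsFlat m D S) {w : ℂ} {c : ℝ} (hc : 0 < c)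
    (hw : ∀ t ∈ J, c ≤ ‖1 - Complex.exp (w - z t)‖) :
    MeasureTheory.IntegrableOn (fun t => (1 - Complex.exp (w - z t))⁻¹ • D (z t)) J := by
  refine h.integrable_smul hD hflat (h.measurable_kernel w).aestronglyMeasurable 0 (B := c⁻¹)
    fun t ht => ?_
  rw [norm_inv]
  simpa using inv_anti₀ hc (hw t ht)

/-- With `q = exp (w - z t)`, subtracting the first `n` powers of `q` from `1 / (1 - q)` leaves `q ^
n / (1 - q)`. The factor `exp (-n Re z)` in it is cancelled by flatness of order `n`. -/
lemma unifExp (h : IsPath J z S) (hm : ∀ n, 0 ≤ m n) (hD : ContinuousOn D S)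
    (hflat : IsFlat m D S) {W : Set ℂ} {c : ℝ} (hc : 0 < c)
    (hW : ∀ w ∈ W, ∀ t ∈ J, c ≤ ‖1 - Complex.exp (w - z t)‖) :
    UnifExp m (moment J z D) (cauchyTransform J z D) W := by
  obtain ⟨C, A, hC, hA, hb⟩ := id hflat
  have hI : 0 ≤ ∫ t in J, Real.exp (z t).re := MeasureTheory.integral_nonneg fun t =>
    (Real.exp_pos _).le
  -- The `+ 1` keeps the constant positive even when the integral over `J` vanishes.
  refine ⟨c⁻¹ * C * ((∫ t in J, Real.exp (z t).re) + 1), A, by positivity, hA,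
    fun n w hw => ?_⟩
  have hne : ∀ t ∈ J, 1 - Complex.exp (w - z t) ≠ 0 := fun t ht h0 => by
    have := hW w hw t ht
    rw [h0, norm_zero] at this
    linarith
  have e1 : ∀ t ∈ J, (1 - Complex.exp (w - z t))⁻¹ • D (z t) -
      ∑ p ∈ Finset.range n, Complex.exp (p * w) • Complex.exp (-(p * z t)) • D (z t) =
      (Complex.exp (w - z t) ^ n * (1 - Complex.exp (w - z t))⁻¹) • D (z t) := fun t ht => by
    have e2 : ∀ p : ℕ, Complex.exp (p * w) • Complex.exp (-(p * z t)) • D (z t) =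
        (Complex.exp (w - z t) ^ p) • D (z t) := fun p => by
      rw [smul_smul, ← Complex.exp_add, ← Complex.exp_nat_mul]
      congr 2
      ring
    simp only [e2]
    rw [← Finset.sum_smul, ← sub_smul]
    congr 1
    have hg := geom_sum_mul_neg (Complex.exp (w - z t)) n
    have h0 := hne t ht
    field_simp
    linear_combination -hg
  have e3 : cauchyTransform J z D w - ∑ p ∈ Finset.range n, Complex.exp (p * w) • moment J z D p =
      ∫ t in J, (Complex.exp (w - z t) ^ n * (1 - Complex.exp (w - z t))⁻¹) • D (z t) := by
    rw [← MeasureTheory.setIntegral_congr_fun h.measurableSet e1, MeasureTheory.integral_sub,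
      MeasureTheory.integral_finsetSum]
    · simp only [MeasureTheory.integral_smul]
      rfl
    · exact fun p _ => (h.integrable_moment hD hflat p).smul _
    · exact h.integrable_cauchyTransform hD hflat hc (hW w hw)
    · exact MeasureTheory.integrable_finsetSum _
        fun p _ => (h.integrable_moment hD hflat p).smul _
  rw [e3]
  have hmn := hm n
  calc _ ≤ ∫ t in J, (c⁻¹ * C * A ^ n * m n * Real.exp (n * w.re)) * Real.exp (z t).re := by
        refine MeasureTheory.norm_integral_le_of_norm_le (h.integrableOn.const_mul _) ?_
        refine (MeasureTheory.ae_restrict_iff' h.measurableSet).2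
          (Eventually.of_forall fun t ht => ?_)
        rw [norm_smul, norm_mul, norm_inv, norm_pow, Complex.norm_exp, Complex.sub_re,
          ← Real.exp_nat_mul]
        calc _ ≤ Real.exp (n * (w.re - (z t).re)) * c⁻¹ *
              (C * A ^ n * m n * Real.exp (n * (z t).re) * Real.exp (z t).re) := by
              gcongr
              · exact hW w hw t ht
              · exact hb n _ (h.mapsTo ht)
          _ = c⁻¹ * C * A ^ n * m n * (Real.exp (n * (w.re - (z t).re)) *
                Real.exp (n * (z t).re)) * Real.exp (z t).re := by ring
          _ = _ := by rw [← Real.exp_add]; ring_nf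
    _ = (c⁻¹ * C * A ^ n * m n * Real.exp (n * w.re)) * ∫ t in J, Real.exp (z t).re :=
        MeasureTheory.integral_const_mul _ _
    _ ≤ (c⁻¹ * C * A ^ n * m n * Real.exp (n * w.re)) *
          ((∫ t in J, Real.exp (z t).re) + 1) := by
        gcongr
        linarith
    _ = _ := by ring

lemma differentiableAt (h : IsPath J z S) (hD : ContinuousOn D S) (hflat : IsFlat m D S)
    {w₀ : ℂ} {W : Set ℂ} (hWn : W ∈ 𝓝 w₀) {c : ℝ} (hc : 0 < c)
    (hW : ∀ w ∈ W, ∀ t ∈ J, c ≤ ‖1 - Complex.exp (w - z t)‖) :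
    DifferentiableAt ℂ (cauchyTransform J z D) w₀ := by
  have hw₀ := mem_of_mem_nhds hWn
  have hz := h.continuous
  have hne : ∀ w ∈ W, ∀ t ∈ J, 1 - Complex.exp (w - z t) ≠ 0 := fun w hw t ht h0 => by
    have := hW w hw t ht
    rw [h0, norm_zero] at this
    linarith
  refine (hasDerivAt_integral_of_dominated_loc_of_deriv_le
    (F := fun w t => (1 - Complex.exp (w - z t))⁻¹ • D (z t))
    (F' := fun w t => (Complex.exp (w - z t) * ((1 - Complex.exp (w - z t))⁻¹ ^ 2)) • D (z t))
    -- With `d = ‖1 - exp u‖ ≥ c` and `‖exp u‖ ≤ 1 + d`, the derivative of the kernel is at most `(1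
    -- + d) / d ^ 2 ≤ c⁻¹ ^ 2 + c⁻¹`.
    (bound := fun t => (c⁻¹ ^ 2 + c⁻¹) * ‖D (z t)‖) hWn
    (Eventually.of_forall fun w => ?_) (h.integrable_cauchyTransform hD hflat hc (hW _ hw₀))
    ?_ ?_ ((h.integrable hD hflat).norm.const_mul _) ?_).2.differentiableAt
  · exact (h.measurable_kernel w).aestronglyMeasurable.smul (h.aestronglyMeasurable hD)
  · refine MeasureTheory.AEStronglyMeasurable.smul ?_ (h.aestronglyMeasurable hD)
    exact ((Continuous.measurable (by fun_prop)).mul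
      ((h.measurable_kernel w₀).pow_const 2)).aestronglyMeasurable
  · refine (MeasureTheory.ae_restrict_iff' h.measurableSet).2
      (Eventually.of_forall fun t ht w hw => ?_)
    rw [norm_smul, norm_mul, norm_pow, norm_inv]
    gcongr
    have h1 := hW w hw t ht
    have h2 : ‖Complex.exp (w - z t)‖ ≤ 1 + ‖1 - Complex.exp (w - z t)‖ := by
      have := norm_sub_le (1 : ℂ) (1 - Complex.exp (w - z t))
      simpa using this
    have h3 : 0 < ‖1 - Complex.exp (w - z t)‖ := hc.trans_le h1
    calc _ ≤ (1 + ‖1 - Complex.exp (w - z t)‖) * ‖1 - Complex.exp (w - z t)‖⁻¹ ^ 2 := by gcongr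
      _ = ‖1 - Complex.exp (w - z t)‖⁻¹ ^ 2 + ‖1 - Complex.exp (w - z t)‖⁻¹ := by
        field_simp
      _ ≤ _ := by gcongr
  · refine (MeasureTheory.ae_restrict_iff' h.measurableSet).2
      (Eventually.of_forall fun t ht w hw => ?_)
    have h1 : HasDerivAt (fun w => 1 - Complex.exp (w - z t)) (-Complex.exp (w - z t)) w := by
      have := (((hasDerivAt_id w).sub_const (z t)).cexp).const_sub 1
      simpa using this
    have h2 := (h1.fun_inv (hne w hw t ht)).smul_const (D (z t))
    convert h2 using 1
    rw [neg_neg, div_eq_mul_inv, inv_pow]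

end IsPath

lemma cauchyTransform_add_period (J : Set ℝ) (z : ℝ → ℂ) (D : ℂ → E) (w : ℂ) :
    cauchyTransform J z D (w + 2 * Real.pi * Complex.I) = cauchyTransform J z D w := by
  simp only [cauchyTransform]
  congr with t
  rw [add_sub_right_comm, Complex.exp_periodic]

/-! ### Lower bounds for the denominator of the kernel -/

/-- With `r = exp (Re u)` and `x = cos (Im u)`, the square of the right side is `1 - 2 r x + r ^ 2`.
It is at least `1 - x ^ 2` if `x ≥ 0` and at least `1` if `x ≤ 0`; both dominate `(1 - x) / 2 = sin
(Im u / 2) ^ 2`. -/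
lemma abs_sin_half_le_norm_one_sub_exp (u : ℂ) :
    |Real.sin (u.im / 2)| ≤ ‖1 - Complex.exp u‖ := by
  rw [← Real.sqrt_sq (norm_nonneg _), ← Real.sqrt_sq_eq_abs]
  apply Real.sqrt_le_sqrt
  rw [← Complex.normSq_eq_norm_sq, Complex.normSq_apply]
  simp only [Complex.sub_re, Complex.sub_im, Complex.one_re, Complex.one_im, Complex.exp_re,
    Complex.exp_im]
  have h1 : Real.cos u.im = 1 - 2 * Real.sin (u.im / 2) ^ 2 := by
    have := Real.cos_two_mul (u.im / 2)
    rw [mul_div_cancel₀ _ two_ne_zero] at this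
    linear_combination this + 2 * Real.sin_sq_add_cos_sq (u.im / 2)
  have h2 := Real.sin_sq_add_cos_sq u.im
  have h3 := Real.exp_pos u.re
  have h5 := Real.cos_le_one u.im
  have h6 := Real.neg_one_le_cos u.im
  set r := Real.exp u.re
  set x := Real.cos u.im
  have h4 : (1 - r * x) * (1 - r * x) + (0 - r * Real.sin u.im) * (0 - r * Real.sin u.im)
      = 1 - 2 * r * x + r ^ 2 := by linear_combination r ^ 2 * h2
  rw [h4, show Real.sin (u.im / 2) ^ 2 = (1 - x) / 2 by linarith]
  rcases le_total 0 x with hx | hx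
  · nlinarith [sq_nonneg (r - x)]
  · nlinarith [mul_nonneg h3.le (neg_nonneg.2 hx)]

lemma sin_half_le_norm_one_sub_exp {η : ℝ} (h0 : 0 < η) {u : ℂ} (h1 : η ≤ u.im)
    (h2 : u.im ≤ 2 * Real.pi - η) : Real.sin (η / 2) ≤ ‖1 - Complex.exp u‖ := by
  refine le_trans ?_ (abs_sin_half_le_norm_one_sub_exp u)
  refine le_trans ?_ (le_abs_self _)
  rcases le_total (u.im / 2) (Real.pi / 2) with h | h
  · exact Real.sin_le_sin_of_le_of_le_pi_div_two (by linarith [Real.pi_pos]) h (by linarith)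
  · rw [← Real.sin_pi_sub (u.im / 2)]
    exact Real.sin_le_sin_of_le_of_le_pi_div_two (by linarith [Real.pi_pos]) (by linarith)
      (by linarith)

lemma one_sub_exp_le_norm_one_sub_exp {δ : ℝ} {u : ℂ} (h : u.re ≤ -δ) :
    1 - Real.exp (-δ) ≤ ‖1 - Complex.exp u‖ := by
  have h1 := norm_sub_norm_le (1 : ℂ) (Complex.exp u)
  rw [norm_one, Complex.norm_exp] at h1
  have := Real.exp_le_exp.2 h
  linarith

/-! ### Cauchy's theorem and Cauchy's formula on half-strips -/

/-- `f` decays like `exp` towards the left end of `S`. -/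
def HasDecay (f : ℂ → E) (S : Set ℂ) : Prop :=
  ∃ C X : ℝ, ∀ ζ ∈ S, ζ.re ≤ X → ‖f ζ‖ ≤ C * Real.exp ζ.re

lemma ofReal_add_mul_I_mem_logStrip {a b L x y : ℝ} (hx : x < L) (hy : y ∈ Ioo a b) :
    (x + y * Complex.I : ℂ) ∈ logStrip a b L := by
  simpa [logStrip] using ⟨hx, hy⟩

omit [NormedSpace ℂ E] in
lemma HasDecay.mono {f : ℂ → E} {S S' : Set ℂ} (h : HasDecay f S) (hS : S' ⊆ S) :
    HasDecay f S' := by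
  obtain ⟨C, X, h⟩ := h
  exact ⟨C, X, fun ζ hζ => h ζ (hS hζ)⟩

omit [NormedSpace ℂ E] in
lemma HasDecay.integrableOn {f : ℂ → E} {a b L L' θ : ℝ} (h : HasDecay f (logStrip a b L))
    (hf : ContinuousOn f (logStrip a b L)) (hθ : θ ∈ Ioo a b) (hL : L' < L) :
    MeasureTheory.IntegrableOn (fun x : ℝ => f (x + θ * Complex.I)) (Iic L') := by
  obtain ⟨C, X, h⟩ := h
  have hmaps : MapsTo (fun x : ℝ => (x + θ * Complex.I : ℂ)) (Iic L') (logStrip a b L) :=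
    fun x hx => ofReal_add_mul_I_mem_logStrip (lt_of_le_of_lt hx hL) hθ
  have hcont : ContinuousOn (fun x : ℝ => f (x + θ * Complex.I)) (Iic L') :=
    hf.comp (by fun_prop) hmaps
  have h1 : MeasureTheory.IntegrableOn (fun x : ℝ => f (x + θ * Complex.I))
      (Iic (min X L')) := by
    refine ((integrableOn_exp_Iic (min X L')).const_mul C).mono'
      ((hcont.mono (Iic_subset_Iic.2 (min_le_right _ _))).aestronglyMeasurable
        measurableSet_Iic) ?_
    refine (MeasureTheory.ae_restrict_iff' measurableSet_Iic).2
      (Eventually.of_forall fun x hx => ?_)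
    have hx' := le_min_iff.1 (mem_Iic.1 hx)
    simpa using h _ (hmaps (mem_Iic.2 hx'.2)) (by simpa using hx'.1)
  have h2 : MeasureTheory.IntegrableOn (fun x : ℝ => f (x + θ * Complex.I))
      (Icc (min X L') L') :=
    (hcont.mono Icc_subset_Iic_self).integrableOn_Icc
  rw [← Iic_union_Icc_eq_Iic (min_le_right X L')]
  exact h1.union h2

/-- Cauchy's theorem on a half-strip. -/
lemma integral_boundary_halfStrip {f : ℂ → E} {a b L L' θ₀ θ₁ : ℝ}
    (hf : DifferentiableOn ℂ f (logStrip a b L)) (h : HasDecay f (logStrip a b L))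
    (h₀ : θ₀ ∈ Ioo a b) (h₁ : θ₁ ∈ Ioo a b) (h₀₁ : θ₀ ≤ θ₁) (hL : L' < L) :
    (∫ x : ℝ in Iic L', f (x + θ₀ * Complex.I)) +
      Complex.I • (∫ y : ℝ in θ₀..θ₁, f (L' + y * Complex.I)) =
      ∫ x : ℝ in Iic L', f (x + θ₁ * Complex.I) := by
  have hi₀ := h.integrableOn hf.continuousOn h₀ hL
  have hi₁ := h.integrableOn hf.continuousOn h₁ hL
  obtain ⟨C, X, h⟩ := h
  have t₀ := MeasureTheory.intervalIntegral_tendsto_integral_Iic L' hi₀ tendsto_id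
  have t₁ := MeasureTheory.intervalIntegral_tendsto_integral_Iic L' hi₁ tendsto_id
  -- The left side of the rectangle, at real part `N`, disappears as `N → -∞` because of the decay.
  have t₂ : Tendsto (fun N : ℝ => Complex.I • ∫ y : ℝ in θ₀..θ₁, f (N + y * Complex.I)) atBot
      (𝓝 0) := by
    have hb : Tendsto (fun N : ℝ => C * Real.exp N * |θ₁ - θ₀|) atBot (𝓝 0) := by
      have := (Real.tendsto_exp_atBot.const_mul C).mul_const |θ₁ - θ₀|
      simpa using this
    refine squeeze_zero_norm' ?_ hb
    filter_upwards [eventually_le_atBot X, eventually_lt_atBot L] with N hN hNL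
    rw [norm_smul, Complex.norm_I, one_mul]
    refine intervalIntegral.norm_integral_le_of_norm_le_const fun y hy => ?_
    rw [uIoc_of_le h₀₁] at hy
    have := h (N + y * Complex.I) (ofReal_add_mul_I_mem_logStrip hNL
      ⟨h₀.1.trans hy.1, hy.2.trans_lt h₁.2⟩) (by simpa using hN)
    simpa using this
  have key : ∀ᶠ N : ℝ in atBot, (∫ x : ℝ in N..L', f (x + θ₀ * Complex.I)) -
      (∫ x : ℝ in N..L', f (x + θ₁ * Complex.I)) +
      Complex.I • (∫ y : ℝ in θ₀..θ₁, f (L' + y * Complex.I)) -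
      Complex.I • (∫ y : ℝ in θ₀..θ₁, f (N + y * Complex.I)) = 0 := by
    filter_upwards [eventually_le_atBot L'] with N hN
    have := Complex.integral_boundary_rect_eq_zero_of_differentiableOn f
      (N + θ₀ * Complex.I) (L' + θ₁ * Complex.I) (hf.mono fun ζ hζ => by
        rw [Complex.mem_reProdIm] at hζ
        simp only [Complex.add_re, Complex.ofReal_re, Complex.mul_re, Complex.I_re, mul_zero,
          Complex.ofReal_im, Complex.I_im, mul_one, sub_self, add_zero, Complex.add_im,
          Complex.mul_im, zero_add, uIcc_of_le hN, uIcc_of_le h₀₁] at hζ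
        exact ⟨hζ.1.2.trans_lt hL, h₀.1.trans_le hζ.2.1, hζ.2.2.trans_lt h₁.2⟩)
    simpa using this
  have lim := ((t₀.sub t₁).add_const
    (Complex.I • (∫ y : ℝ in θ₀..θ₁, f (L' + y * Complex.I)))).sub t₂
  have := tendsto_nhds_unique (lim.congr' key) tendsto_const_nhds
  rw [sub_zero] at this
  rw [← sub_eq_zero, ← this]
  abel

lemma exp_ne_one_of_im {u : ℂ} (h : |u.im| < 2 * Real.pi) (hu : u ≠ 0) : Complex.exp u ≠ 1 := by
  intro h1
  obtain ⟨n, hn⟩ := Complex.exp_eq_one_iff.1 h1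
  have him : u.im = n * (2 * Real.pi) := by rw [hn]; simp
  rw [him, abs_mul, abs_of_pos Real.two_pi_pos] at h
  have h2 : |(n : ℝ)| < 1 := by
    by_contra hc
    nlinarith [Real.two_pi_pos, not_lt.1 hc]
  have h3 : n = 0 := by
    rw [← Int.abs_lt_one_iff]
    exact_mod_cast h2
  exact hu (by rw [hn, h3]; simp)

lemma norm_kernel_le {u : ℂ} (h : u.re ≤ -1) :
    ‖(1 - Complex.exp (-u))⁻¹‖ ≤ 2 * Real.exp u.re := by
  have h1 : 2 ≤ Real.exp (-u.re) := by
    have := Real.add_one_le_exp (-u.re)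
    linarith
  have h2 := norm_sub_norm_le (Complex.exp (-u)) 1
  rw [norm_sub_rev, norm_one, Complex.norm_exp, Complex.neg_re] at h2
  rw [norm_inv]
  have h3 : Real.exp (-u.re) / 2 ≤ ‖1 - Complex.exp (-u)‖ := by linarith
  calc _ ≤ (Real.exp (-u.re) / 2)⁻¹ := inv_anti₀ (by positivity) h3
    _ = _ := by rw [Real.exp_neg]; field_simp

/-- The kernel alone decays like `exp (Re ζ)` at the left end, so boundedness of `D` is enough for
Cauchy's theorem on a half-strip. -/
lemma hasDecay_kernel_smul {D : ℂ → E} {S : Set ℂ} {B : ℝ} (hD : ∀ ζ ∈ S, ‖D ζ‖ ≤ B) (w : ℂ) :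
    HasDecay (fun ζ => (1 - Complex.exp (w - ζ))⁻¹ • D ζ) S := by
  refine ⟨2 * Real.exp (-w.re) * B, w.re - 1, fun ζ hζ h => ?_⟩
  rw [norm_smul]
  have h1 := norm_kernel_le (u := ζ - w) (by simpa using by linarith)
  rw [neg_sub, Complex.sub_re, sub_eq_add_neg ζ.re, Real.exp_add] at h1
  calc _ ≤ (2 * (Real.exp ζ.re * Real.exp (-w.re))) * B := by
        gcongr
        exact hD ζ hζ
    _ = _ := by ring

lemma hasDerivAt_log_one_sub_exp {u : ℂ} (hu : 1 - Complex.exp u ∈ Complex.slitPlane) :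
    HasDerivAt (fun u => Complex.log (1 - Complex.exp u)) ((1 - Complex.exp (-u))⁻¹) u := by
  have h := ((Complex.hasDerivAt_exp u).const_sub 1).clog hu
  have hne := Complex.slitPlane_ne_zero hu
  have he := Complex.exp_ne_zero u
  convert h using 1
  rw [Complex.exp_neg]
  have : 1 - (Complex.exp u)⁻¹ ≠ 0 := by
    intro h0
    apply hne
    field_simp at h0
    linear_combination -h0
  have h2 : Complex.exp u - 1 ≠ 0 := fun h0 => hne (by linear_combination -h0)
  field_simp
  ring

lemma hasDerivAt_log_exp_sub_one {u : ℂ} (hu : Complex.exp u - 1 ∈ Complex.slitPlane) :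
    HasDerivAt (fun u => Complex.log (Complex.exp u - 1)) ((1 - Complex.exp (-u))⁻¹) u := by
  have h := ((Complex.hasDerivAt_exp u).sub_const 1).clog hu
  have hne := Complex.slitPlane_ne_zero hu
  have he := Complex.exp_ne_zero u
  convert h using 1
  rw [Complex.exp_neg]
  field_simp

lemma im_exp_pos {u : ℂ} (h0 : 0 < u.im) (h1 : u.im < Real.pi) : 0 < (Complex.exp u).im := by
  rw [Complex.exp_im]
  exact mul_pos (Real.exp_pos _) (Real.sin_pos_of_pos_of_lt_pi h0 h1)

lemma im_exp_neg {u : ℂ} (h0 : u.im < 0) (h1 : -Real.pi < u.im) : (Complex.exp u).im < 0 := by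
  rw [Complex.exp_im]
  exact mul_neg_of_pos_of_neg (Real.exp_pos _) (Real.sin_neg_of_neg_of_neg_pi_lt h0 h1)

lemma exp_sub_one_mem_slitPlane {u : ℂ} (h0 : 0 < u.re) (h1 : |u.im| < Real.pi) :
    Complex.exp u - 1 ∈ Complex.slitPlane := by
  rw [abs_lt] at h1
  rcases lt_trichotomy u.im 0 with h | h | h
  · right
    simpa using (im_exp_neg h h1.1).ne
  · left
    simp only [Complex.sub_re, Complex.exp_re, h, Real.cos_zero, mul_one, Complex.one_re, sub_pos]
    exact Real.one_lt_exp_iff.2 h0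
  · right
    simpa using (im_exp_pos h h1.2).ne'

/-- The integral of the kernel along a horizontal half-line off the real axis. -/
lemma integral_kernel_Iic {w : ℂ} {L' θ : ℝ} (h0 : θ - w.im ≠ 0) (h1 : |θ - w.im| < Real.pi) :
    (∫ x : ℝ in Iic L', (1 - Complex.exp (w - (x + θ * Complex.I)))⁻¹) =
      Complex.log (1 - Complex.exp (L' + θ * Complex.I - w)) := by
  have him : ∀ x : ℝ, (x + θ * Complex.I - w).im = θ - w.im := fun x => by simp
  rw [abs_lt] at h1
  have hslit : ∀ x : ℝ, 1 - Complex.exp (x + θ * Complex.I - w) ∈ Complex.slitPlane := fun x => by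
    right
    simp only [Complex.sub_im, Complex.one_im, zero_sub]
    rcases lt_or_gt_of_ne h0 with h | h
    · exact neg_ne_zero.2 (im_exp_neg (by rwa [him]) (by rw [him]; exact h1.1)).ne
    · exact neg_ne_zero.2 (im_exp_pos (by rwa [him]) (by rw [him]; exact h1.2)).ne'
  have hcont : ContinuousOn (fun ζ => (1 - Complex.exp (w - ζ))⁻¹ • (1 : ℂ))
      (logStrip (θ - |θ - w.im|) (θ + |θ - w.im|) (L' + 1)) := by
    have hc : ContinuousOn (fun ζ => (1 - Complex.exp (w - ζ))⁻¹)
        (logStrip (θ - |θ - w.im|) (θ + |θ - w.im|) (L' + 1)) := by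
      refine ContinuousOn.inv₀ (by fun_prop) fun ζ hζ h => ?_
      obtain ⟨-, h2, h3⟩ := hζ
      have ha : |ζ.im - θ| < |θ - w.im| := abs_lt.2 ⟨by linarith, by linarith⟩
      refine exp_ne_one_of_im (u := w - ζ) ?_ ?_ (by linear_combination -h)
      · rw [Complex.sub_im]
        have := abs_lt.2 h1
        calc |w.im - ζ.im| = |(ζ.im - θ) + (θ - w.im)| := by rw [abs_sub_comm]; congr 1; ring
          _ ≤ |ζ.im - θ| + |θ - w.im| := abs_add_le _ _
          _ < _ := by linarith
      · rintro h4
        rw [sub_eq_zero.1 h4, abs_sub_comm] at ha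
        exact lt_irrefl _ ha
    exact hc.smul continuousOn_const
  have hpos : 0 < |θ - w.im| := abs_pos.2 h0
  have hint := (hasDecay_kernel_smul (D := fun _ => (1 : ℂ)) (B := 1)
    (S := logStrip (θ - |θ - w.im|) (θ + |θ - w.im|) (L' + 1)) (by simp) w).integrableOn hcont
    (θ := θ) (L' := L') ⟨by linarith, by linarith⟩ (by linarith)
  simp only [smul_eq_mul, mul_one] at hint
  -- The primitive `log (1 - exp (ζ - w))` is holomorphic along the line, since the line is off the
  -- real direction of `w`, and it tends to `log 1 = 0` at the left end.
  rw [MeasureTheory.integral_Iic_of_hasDerivAt_of_tendsto' (m := 0)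
    (f := fun x : ℝ => Complex.log (1 - Complex.exp (x + θ * Complex.I - w))) _ hint, sub_zero]
  · have ht : Tendsto (fun x : ℝ => Complex.exp (x + θ * Complex.I - w)) atBot (𝓝 0) := by
      rw [tendsto_zero_iff_norm_tendsto_zero]
      simp only [Complex.norm_exp, Complex.sub_re, Complex.add_re, Complex.ofReal_re,
        Complex.mul_re, Complex.I_re, mul_zero, Complex.ofReal_im, Complex.I_im, mul_one, sub_self,
        add_zero]
      exact Real.tendsto_exp_atBot.comp (tendsto_atBot_add_const_right _ (-w.re) tendsto_id)
    have := (ht.const_sub 1).clog (by simp)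
    simpa using this
  · intro x _
    have hin : HasDerivAt (fun ζ : ℂ => ζ + θ * Complex.I - w) 1 (x : ℂ) :=
      ((hasDerivAt_id (x : ℂ)).add_const _).sub_const _
    have := ((hasDerivAt_log_one_sub_exp (hslit x)).comp (x : ℂ) hin).comp_ofReal
    simpa using this

lemma log_neg_sub_log_of_im_neg {v : ℂ} (hv : v.im < 0) :
    Complex.log (-v) - Complex.log v = Real.pi * Complex.I := by
  rw [Complex.log, Complex.log, norm_neg, Complex.arg_neg_eq_arg_add_pi_of_im_neg hv]
  push_cast
  ring

lemma log_neg_sub_log_of_im_pos {v : ℂ} (hv : 0 < v.im) :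
    Complex.log (-v) - Complex.log v = -(Real.pi * Complex.I) := by
  rw [Complex.log, Complex.log, norm_neg, Complex.arg_neg_eq_arg_sub_pi_of_im_pos hv]
  push_cast
  ring

/-- The residue of the kernel. -/
lemma integral_boundary_kernel {w : ℂ} {L' θ₀ θ₁ : ℝ} (hw : w.re < L') (h₀ : θ₀ < w.im)
    (h₁ : w.im < θ₁) (h₀' : w.im - θ₀ < Real.pi) (h₁' : θ₁ - w.im < Real.pi) :
    (∫ x : ℝ in Iic L', (1 - Complex.exp (w - (x + θ₀ * Complex.I)))⁻¹) +
      Complex.I • (∫ y : ℝ in θ₀..θ₁, (1 - Complex.exp (w - (L' + y * Complex.I)))⁻¹) -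
      (∫ x : ℝ in Iic L', (1 - Complex.exp (w - (x + θ₁ * Complex.I)))⁻¹) =
      2 * Real.pi * Complex.I := by
  have him : ∀ y : ℝ, (L' + y * Complex.I - w).im = y - w.im := fun y => by simp
  rw [integral_kernel_Iic (by linarith) (abs_lt.2 ⟨by linarith, by linarith⟩),
    integral_kernel_Iic (by linarith) (abs_lt.2 ⟨by linarith, by linarith⟩)]
  -- On the vertical side `Re (ζ - w) > 0`, so `1 - exp (ζ - w)` meets the cut of the logarithm
  -- while `exp (ζ - w) - 1` avoids it; the primitive is changed accordingly.
  have hslit : ∀ y ∈ uIcc θ₀ θ₁, Complex.exp (L' + y * Complex.I - w) - 1 ∈ Complex.slitPlane := by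
    intro y hy
    rw [uIcc_of_le (by linarith)] at hy
    refine exp_sub_one_mem_slitPlane (by simpa using hw) ?_
    rw [him]
    exact abs_lt.2 ⟨by linarith [hy.1], by linarith [hy.2]⟩
  have hderiv : ∀ y ∈ uIcc θ₀ θ₁, HasDerivAt
      (fun y : ℝ => Complex.log (Complex.exp (L' + y * Complex.I - w) - 1))
      (Complex.I * (1 - Complex.exp (w - (L' + y * Complex.I)))⁻¹) y := by
    intro y hy
    have hin : HasDerivAt (fun ζ : ℂ => L' + ζ * Complex.I - w) Complex.I (y : ℂ) := by
      have := ((((hasDerivAt_id (y : ℂ)).mul_const Complex.I).const_add (L' : ℂ)).sub_const w)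
      simpa using this
    have := ((hasDerivAt_log_exp_sub_one (hslit y hy)).comp (y : ℂ) hin).comp_ofReal
    rw [neg_sub, mul_comm] at this
    exact this
  have hcont : ContinuousOn (fun y : ℝ =>
      Complex.I * (1 - Complex.exp (w - (L' + y * Complex.I)))⁻¹) (uIcc θ₀ θ₁) := by
    refine continuousOn_const.mul (ContinuousOn.inv₀ (by fun_prop) fun y hy h => ?_)
    have h2 := Complex.slitPlane_ne_zero (hslit y hy)
    apply h2
    rw [← neg_sub w, Complex.exp_neg, ← sub_eq_zero.1 h]
    simp
  have hvert := intervalIntegral.integral_eq_sub_of_hasDerivAt hderiv hcont.intervalIntegrable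
  rw [intervalIntegral.integral_const_mul] at hvert
  rw [smul_eq_mul, hvert]
  -- The two primitives differ by `πi` at the lower corner and by `-πi` at the upper one; the
  -- difference of these constants is the residue `2πi`.
  have e₀ := log_neg_sub_log_of_im_neg (v := Complex.exp (L' + θ₀ * Complex.I - w) - 1) (by
    simpa using im_exp_neg (u := L' + θ₀ * Complex.I - w) (by rw [him]; linarith)
      (by rw [him]; linarith))
  have e₁ := log_neg_sub_log_of_im_pos (v := Complex.exp (L' + θ₁ * Complex.I - w) - 1) (by
    simpa using im_exp_pos (u := L' + θ₁ * Complex.I - w) (by rw [him]; linarith)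
      (by rw [him]; linarith))
  rw [neg_sub] at e₀ e₁
  linear_combination e₀ - e₁

section Cauchy

variable [CompleteSpace E] {D : ℂ → E} {a b L L' θ₀ θ₁ B : ℝ} {w : ℂ}

omit [CompleteSpace E] in
/-- Cauchy's theorem for the periodic kernel. -/
lemma integral_boundary_kernel_smul_of_notMem (hD : DifferentiableOn ℂ D (logStrip a b L))
    (hB : ∀ ζ ∈ logStrip a b L, ‖D ζ‖ ≤ B) (h₀ : θ₀ ∈ Ioo a b) (h₁ : θ₁ ∈ Ioo a b)
    (h₀₁ : θ₀ ≤ θ₁) (hL : L' < L) (hw₁ : θ₁ < w.im) (hw₀ : w.im < θ₀ + 2 * Real.pi) :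
    (∫ x : ℝ in Iic L', (1 - Complex.exp (w - (x + θ₀ * Complex.I)))⁻¹ •
        D (x + θ₀ * Complex.I)) +
      Complex.I • (∫ y : ℝ in θ₀..θ₁, (1 - Complex.exp (w - (L' + y * Complex.I)))⁻¹ •
        D (L' + y * Complex.I)) =
      ∫ x : ℝ in Iic L', (1 - Complex.exp (w - (x + θ₁ * Complex.I)))⁻¹ •
        D (x + θ₁ * Complex.I) := by
  -- The strip is cut down to `0 < Im (w - ζ) < 2π`, where the kernel has no pole.
  have hsub : logStrip (max a (w.im - 2 * Real.pi)) (min b w.im) L ⊆ logStrip a b L :=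
    fun ζ hζ => ⟨hζ.1, (le_max_left _ _).trans_lt hζ.2.1, hζ.2.2.trans_le (min_le_left _ _)⟩
  have hdec := hasDecay_kernel_smul (fun ζ hζ => hB ζ (hsub hζ)) w
  refine integral_boundary_halfStrip (DifferentiableOn.smul ?_ (hD.mono hsub)) hdec
    ⟨max_lt h₀.1 (by linarith), lt_min h₀.2 (by linarith)⟩
    ⟨max_lt h₁.1 (by linarith), lt_min h₁.2 (by linarith)⟩ h₀₁ hL
  refine DifferentiableOn.inv (by fun_prop) fun ζ hζ h => ?_
  have h2 := (le_max_right _ _).trans_lt hζ.2.1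
  have h3 := hζ.2.2.trans_le (min_le_right _ _)
  refine exp_ne_one_of_im (u := w - ζ) ?_ ?_ (by linear_combination -h)
  · rw [Complex.sub_im]
    exact abs_lt.2 ⟨by linarith, by linarith⟩
  · intro h4
    rw [sub_eq_zero.1 h4] at h3
    exact lt_irrefl _ h3

/-- Cauchy's formula for the periodic kernel. -/
lemma integral_boundary_kernel_smul_of_mem (hD : DifferentiableOn ℂ D (logStrip a b L))
    (hB : ∀ ζ ∈ logStrip a b L, ‖D ζ‖ ≤ B) (hab : b ≤ a + 2 * Real.pi)
    (h₀ : θ₀ ∈ Ioo a b) (h₁ : θ₁ ∈ Ioo a b)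
    (hL : L' < L) (hw₀ : θ₀ < w.im) (hw₁ : w.im < θ₁) (hpi : θ₁ - θ₀ ≤ Real.pi)
    (hw : w.re < L') :
    (∫ x : ℝ in Iic L', (1 - Complex.exp (w - (x + θ₀ * Complex.I)))⁻¹ •
        D (x + θ₀ * Complex.I)) +
      Complex.I • (∫ y : ℝ in θ₀..θ₁, (1 - Complex.exp (w - (L' + y * Complex.I)))⁻¹ •
        D (L' + y * Complex.I)) =
      (∫ x : ℝ in Iic L', (1 - Complex.exp (w - (x + θ₁ * Complex.I)))⁻¹ •
        D (x + θ₁ * Complex.I)) + (2 * Real.pi * Complex.I) • D w := by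
  set S := logStrip a b L
  have hS : IsOpen S := isOpen_logStrip a b L
  have hwS : w ∈ S := ⟨hw.trans hL, h₀.1.trans hw₀, hw₁.trans h₁.2⟩
  have hSn : S ∈ 𝓝 w := hS.mem_nhds hwS
  set k : ℂ → ℂ := fun ζ => (1 - Complex.exp (w - ζ))⁻¹
  set H : ℂ → ℂ := fun ζ => 1 - Complex.exp (w - ζ)
  have hHd : DifferentiableOn ℂ H S := by fun_prop
  have hHw : H w = 0 := by simp [H]
  have hHne : ∀ ζ ∈ S, ζ ≠ w → H ζ ≠ 0 := fun ζ hζ hne h => by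
    refine exp_ne_one_of_im (u := w - ζ) ?_ (sub_ne_zero.2 hne.symm) (by linear_combination -h)
    rw [Complex.sub_im]
    exact abs_lt.2 ⟨by linarith [hζ.2.2, hwS.2.1], by linarith [hζ.2.1, hwS.2.2]⟩
  -- `q` is the kernel times `D ζ - D w`, written with difference quotients so that the removable
  -- singularity at `w` is filled. Cauchy's theorem applies to `q`, and the subtracted multiple of
  -- `D w` contributes the residue.
  set q : ℂ → E := fun ζ => (dslope H w ζ)⁻¹ • dslope D w ζ
  have hq : ∀ ζ, ζ ≠ w → q ζ = k ζ • (D ζ - D w) := fun ζ hne => by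
    have h1 : H ζ = (ζ - w) * dslope H w ζ := by
      have := sub_smul_dslope H w ζ
      rw [hHw, sub_zero] at this
      exact this.symm
    have h2 := sub_smul_dslope D w ζ
    rw [← h2, smul_smul]
    show _ = ((H ζ)⁻¹ * (ζ - w)) • _
    have h3 := sub_ne_zero.2 hne
    rw [h1, mul_inv_rev, mul_assoc, inv_mul_cancel₀ h3, mul_one]
  have hqd : DifferentiableOn ℂ q S := by
    refine DifferentiableOn.smul (DifferentiableOn.inv
      ((Complex.differentiableOn_dslope hSn).2 hHd) fun ζ hζ h => ?_)
      ((Complex.differentiableOn_dslope hSn).2 hD)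
    by_cases hne : ζ = w
    · have hder : HasDerivAt H 1 w := by
        have := (((hasDerivAt_id w).const_sub w).cexp).const_sub 1
        simpa using this
      rw [hne, dslope_same, hder.deriv] at h
      exact one_ne_zero h
    · refine hHne ζ hζ hne ?_
      have := sub_smul_dslope H w ζ
      rw [hHw, sub_zero, h, smul_zero] at this
      exact this.symm
  have hqdec : HasDecay q S := by
    obtain ⟨C, X, h⟩ := hasDecay_kernel_smul (D := fun ζ => D ζ - D w) (S := S) (B := B + ‖D w‖)
      (fun ζ hζ => (norm_sub_le _ _).trans (by gcongr; exact hB ζ hζ)) w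
    refine ⟨C, min X (w.re - 1), fun ζ hζ hX => ?_⟩
    rw [hq ζ (by rintro rfl; linarith [hX.trans (min_le_right _ _)])]
    exact h ζ hζ (hX.trans (min_le_left _ _))
  have main := integral_boundary_halfStrip hqd hqdec h₀ h₁ (by linarith) hL
  have hDb := hasDecay_kernel_smul hB w
  have hkb := hasDecay_kernel_smul (D := fun _ => D w) (S := S) (B := ‖D w‖) (by simp) w
  have hres := integral_boundary_kernel hw hw₀ hw₁ (by linarith) (by linarith)
  have hcont : ∀ s ⊆ S, w ∉ s → ContinuousOn k s := fun s hs hws =>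
    ContinuousOn.inv₀ (by fun_prop) fun ζ hζ => hHne ζ (hs hζ) (by rintro rfl; exact hws hζ)
  have hline : ∀ θ ∈ Ioo a b, θ ≠ w.im →
      (∫ x : ℝ in Iic L', q (x + θ * Complex.I)) =
        (∫ x : ℝ in Iic L', k (x + θ * Complex.I) • D (x + θ * Complex.I)) -
        (∫ x : ℝ in Iic L', k (x + θ * Complex.I)) • D w := by
    intro θ hθ hne
    obtain ⟨a', b', hθ', hsub, hw'⟩ : ∃ a' b', θ ∈ Ioo a' b' ∧ logStrip a' b' L ⊆ S ∧
        w ∉ logStrip a' b' L := by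
      rcases lt_or_gt_of_ne hne with h | h
      · exact ⟨a, w.im, ⟨hθ.1, h⟩, fun ζ hζ => ⟨hζ.1, hζ.2.1, hζ.2.2.trans hwS.2.2⟩,
          fun hc => lt_irrefl _ hc.2.2⟩
      · exact ⟨w.im, b, ⟨h, hθ.2⟩, fun ζ hζ => ⟨hζ.1, hwS.2.1.trans hζ.2.1, hζ.2.2⟩,
          fun hc => lt_irrefl _ hc.2.1⟩
    have hk := hcont _ hsub hw'
    have i1 := (hDb.mono hsub).integrableOn (hk.smul (hD.continuousOn.mono hsub)) hθ' hL
    have i2 := (hkb.mono hsub).integrableOn (hk.smul continuousOn_const) hθ' hL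
    rw [← integral_smul_const, ← MeasureTheory.integral_sub i1 i2]
    refine MeasureTheory.integral_congr_ae (Eventually.of_forall fun x => ?_)
    have hx : (x + θ * Complex.I : ℂ) ≠ w := fun h => hne (by rw [← h]; simp)
    simp only [hq _ hx, smul_sub]
    rfl
  have hvert : (∫ y : ℝ in θ₀..θ₁, q (L' + y * Complex.I)) =
        (∫ y : ℝ in θ₀..θ₁, k (L' + y * Complex.I) • D (L' + y * Complex.I)) -
        (∫ y : ℝ in θ₀..θ₁, k (L' + y * Complex.I)) • D w := by
    have hmap : MapsTo (fun y : ℝ => (L' + y * Complex.I : ℂ)) (uIcc θ₀ θ₁)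
        (S \ {w}) := fun y hy => by
      rw [uIcc_of_le (by linarith)] at hy
      refine ⟨ofReal_add_mul_I_mem_logStrip hL ⟨h₀.1.trans_le hy.1, hy.2.trans_lt h₁.2⟩,
        fun h => hw.ne ?_⟩
      rw [← mem_singleton_iff.1 h]
      simp
    have hk : ContinuousOn (fun y : ℝ => k (L' + y * Complex.I)) (uIcc θ₀ θ₁) :=
      (hcont _ sdiff_subset (by simp)).comp (by fun_prop) hmap
    have hDc : ContinuousOn (fun y : ℝ => D (L' + y * Complex.I)) (uIcc θ₀ θ₁) :=
      (hD.continuousOn.mono sdiff_subset).comp (by fun_prop) hmap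
    rw [← intervalIntegral.integral_smul_const, ← intervalIntegral.integral_sub
      (ContinuousOn.intervalIntegrable (hk.fun_smul hDc))
      (ContinuousOn.intervalIntegrable (hk.fun_smul continuousOn_const))]
    refine intervalIntegral.integral_congr fun y hy => ?_
    simp only [hq _ (hmap hy).2, smul_sub]
  rw [hline θ₀ h₀ hw₀.ne, hline θ₁ h₁ hw₁.ne', hvert] at main
  have hres' := congrArg (fun c : ℂ => c • D w) hres
  simp only [sub_smul, add_smul, smul_eq_mul, mul_smul] at hres'
  simp only [smul_sub] at main
  simp only [mul_smul]
  rw [← hres', ← sub_eq_zero]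
  rw [← sub_eq_zero] at main
  rw [← main]
  simp only [k]
  abel

end Cauchy

/-! ### Cauchy–Heine integrals along straight and bent rays -/

lemma isPath_ray {a b L θ : ℝ} (hθ : θ ∈ Ioo a b) {J : Set ℝ} (hJ : MeasurableSet J)
    (hJL : J ⊆ Iio L) : IsPath J (fun x : ℝ => (x + θ * Complex.I : ℂ)) (logStrip a b L) where
  measurableSet := hJ
  continuous := by fun_prop
  mapsTo x hx := ofReal_add_mul_I_mem_logStrip (hJL hx) hθ
  integrableOn := by
    simpa using (integrableOn_exp_Iic L).mono_set (hJL.trans Iio_subset_Iic_self)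

lemma isPath_segment {a b L L' θ₀ θ₁ : ℝ} (h₀ : θ₀ ∈ Ioo a b) (h₁ : θ₁ ∈ Ioo a b) (hL : L' < L) :
    IsPath (Ioc θ₀ θ₁) (fun y : ℝ => (L' + y * Complex.I : ℂ)) (logStrip a b L) where
  measurableSet := measurableSet_Ioc
  continuous := by fun_prop
  mapsTo y hy := ofReal_add_mul_I_mem_logStrip hL ⟨h₀.1.trans hy.1, hy.2.trans_lt h₁.2⟩
  integrableOn := by simp

/-- The Cauchy–Heine integral of `D` along the ray of argument `θ`. -/
noncomputable def rayTransform (L θ : ℝ) (D : ℂ → E) (w : ℂ) : E :=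
  (2 * Real.pi * Complex.I)⁻¹ •
    cauchyTransform (Iio L) (fun x : ℝ => (x + θ * Complex.I : ℂ)) D w

/-- The coefficients of the expansion of `rayTransform`. -/
noncomputable def rayMoment (L θ : ℝ) (D : ℂ → E) (p : ℕ) : E :=
  (2 * Real.pi * Complex.I)⁻¹ • moment (Iio L) (fun x : ℝ => (x + θ * Complex.I : ℂ)) D p

/-- The Cauchy–Heine integral of `D` along the path which follows the ray of argument `θ₀` up to
modulus `exp L'` and then the ray of argument `θ₁`. -/
noncomputable def bentTransform (L L' θ₀ θ₁ : ℝ) (D : ℂ → E) (w : ℂ) : E :=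
  (2 * Real.pi * Complex.I)⁻¹ •
    (cauchyTransform (Iic L') (fun x : ℝ => (x + θ₀ * Complex.I : ℂ)) D w +
      Complex.I • cauchyTransform (Ioc θ₀ θ₁) (fun y : ℝ => (L' + y * Complex.I : ℂ)) D w +
      cauchyTransform (Ioo L' L) (fun x : ℝ => (x + θ₁ * Complex.I : ℂ)) D w)

lemma rayTransform_add_period (L θ : ℝ) (D : ℂ → E) (w : ℂ) :
    rayTransform L θ D (w + 2 * Real.pi * Complex.I) = rayTransform L θ D w := by
  simp only [rayTransform, cauchyTransform_add_period]

lemma sin_half_le_norm_one_sub_exp_of_abs {η : ℝ} (h0 : 0 < η) {u : ℂ} (h1 : η ≤ |u.im|)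
    (h2 : |u.im| ≤ 2 * Real.pi - η) : Real.sin (η / 2) ≤ ‖1 - Complex.exp u‖ := by
  rcases abs_cases u.im with ⟨h, _⟩ | ⟨h, _⟩
  · rw [h] at h1 h2
    exact sin_half_le_norm_one_sub_exp h0 h1 h2
  · rw [h] at h1 h2
    rw [← Complex.exp_periodic]
    exact sin_half_le_norm_one_sub_exp h0 (by simp; linarith) (by simp; linarith)

/-- Points whose argument stays `η`-away from `θ` modulo `2π`. -/
def awayFrom (θ η : ℝ) : Set ℂ := {w | η ≤ |w.im - θ| ∧ |w.im - θ| ≤ 2 * Real.pi - η}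

lemma exists_awayFrom_mem_nhds {θ : ℝ} {w : ℂ} (h0 : 0 < |w.im - θ|)
    (h1 : |w.im - θ| < 2 * Real.pi) : ∃ η, 0 < η ∧ η < Real.pi ∧ awayFrom θ η ∈ 𝓝 w := by
  obtain ⟨η, hη0, hη⟩ := exists_between (lt_min h0 (sub_pos.2 h1))
  have hη1 := hη.trans_le (min_le_left _ _)
  have hη2 := hη.trans_le (min_le_right _ _)
  refine ⟨η, hη0, by linarith, ?_⟩
  have hc : Continuous fun w : ℂ => |w.im - θ| := (Complex.continuous_im.sub continuous_const).abs
  have hc1 : ∀ᶠ v : ℂ in 𝓝 w, η < |v.im - θ| := hc.continuousAt.eventually (lt_mem_nhds hη1)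
  have hc2 : ∀ᶠ v : ℂ in 𝓝 w, |v.im - θ| < 2 * Real.pi - η :=
    hc.continuousAt.eventually (gt_mem_nhds (by linarith))
  filter_upwards [hc1, hc2] with v hv1 hv2
  exact ⟨hv1.le, hv2.le⟩

lemma awayFrom_kernel {θ η : ℝ} (h0 : 0 < η) {w : ℂ} (hw : w ∈ awayFrom θ η) (t : ℝ) :
    Real.sin (η / 2) ≤ ‖1 - Complex.exp (w - (t + θ * Complex.I))‖ :=
  sin_half_le_norm_one_sub_exp_of_abs h0 (by simpa using hw.1) (by simpa using hw.2)

lemma left_kernel {L' δ : ℝ} {w ζ : ℂ} (hw : w.re ≤ L' - δ) (hζ : L' ≤ ζ.re) :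
    1 - Real.exp (-δ) ≤ ‖1 - Complex.exp (w - ζ)‖ :=
  one_sub_exp_le_norm_one_sub_exp (by rw [Complex.sub_re]; linarith)

lemma sin_half_pos {η : ℝ} (h0 : 0 < η) (h1 : η < Real.pi) : 0 < Real.sin (η / 2) :=
  Real.sin_pos_of_pos_of_lt_pi (by linarith) (by linarith [Real.pi_pos])

lemma one_sub_exp_neg_pos {δ : ℝ} (h0 : 0 < δ) : 0 < 1 - Real.exp (-δ) := by
  have := Real.exp_lt_exp.2 (neg_lt_zero.2 h0)
  rw [Real.exp_zero] at this
  linarith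

section

variable {D : ℂ → E} {m : ℕ → ℝ} {a b L L' θ θ₀ θ₁ : ℝ}

lemma rayTransform_differentiableAt (hD : ContinuousOn D (logStrip a b L))
    (hflat : IsFlat m D (logStrip a b L)) (hθ : θ ∈ Ioo a b) {w : ℂ} (h0 : 0 < |w.im - θ|)
    (h1 : |w.im - θ| < 2 * Real.pi) : DifferentiableAt ℂ (rayTransform L θ D) w := by
  obtain ⟨η, hη, hη', hn⟩ := exists_awayFrom_mem_nhds h0 h1
  exact ((isPath_ray hθ measurableSet_Iio subset_rfl).differentiableAt hD hflat hn
    (sin_half_pos hη hη') fun w hw t _ => awayFrom_kernel hη hw t).const_smul _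

lemma rayTransform_unifExp (hm : ∀ n, 0 ≤ m n) (hD : ContinuousOn D (logStrip a b L))
    (hflat : IsFlat m D (logStrip a b L)) (hθ : θ ∈ Ioo a b) {η : ℝ} (h0 : 0 < η)
    (h1 : η < Real.pi) : UnifExp m (rayMoment L θ D) (rayTransform L θ D) (awayFrom θ η) :=
  ((isPath_ray hθ measurableSet_Iio subset_rfl).unifExp hm hD hflat (sin_half_pos h0 h1)
    fun _ hw t _ => awayFrom_kernel h0 hw t).const_smul hm _

/-- Only the initial ray of argument `θ₀` constrains the argument of `w`: the arc and the final ray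
have real part at least `L'`, to the right of `w`, where the kernel is harmless. -/
lemma bentTransform_differentiableAt (hD : ContinuousOn D (logStrip a b L))
    (hflat : IsFlat m D (logStrip a b L)) (hθ₀ : θ₀ ∈ Ioo a b) (hθ₁ : θ₁ ∈ Ioo a b)
    (hL : L' < L) {w : ℂ} (hw : w.re < L') (h0 : 0 < |w.im - θ₀|)
    (h1 : |w.im - θ₀| < 2 * Real.pi) : DifferentiableAt ℂ (bentTransform L L' θ₀ θ₁ D) w := by
  obtain ⟨η, hη, hη', hn⟩ := exists_awayFrom_mem_nhds h0 h1
  obtain ⟨δ, hδ, hδ'⟩ := exists_between (sub_pos.2 hw)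
  have hn' : {w : ℂ | w.re ≤ L' - δ} ∈ 𝓝 w := by
    filter_upwards [Complex.continuous_re.continuousAt.eventually
      (gt_mem_nhds (show w.re < L' - δ by linarith))] with v hv using le_of_lt hv
  have hδ1 := one_sub_exp_neg_pos hδ
  refine (((((isPath_ray hθ₀ measurableSet_Iic (Iic_subset_Iio.2 hL)).differentiableAt hD hflat hn
    (sin_half_pos hη hη') fun w hw t _ => awayFrom_kernel hη hw t)).add
    (((isPath_segment hθ₀ hθ₁ hL).differentiableAt hD hflat hn' hδ1
      fun w hw t _ => left_kernel hw (by simp)).const_smul _)).add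
    ((isPath_ray hθ₁ measurableSet_Ioo Ioo_subset_Iio_self).differentiableAt hD hflat hn' hδ1
      fun w hw t ht => left_kernel hw (by simpa using ht.1.le))).const_smul _

/-- The integrand `exp (-p ζ) D ζ` is holomorphic in the strip and decays by flatness of order `p`,
so moments do not see the bending of the path. This is why the analytic continuation keeps its
expansion. -/
lemma moment_eq_of_halfStrip (hD : DifferentiableOn ℂ D (logStrip a b L))
    (hflat : IsFlat m D (logStrip a b L)) (hθ₀ : θ₀ ∈ Ioo a b) (hθ₁ : θ₁ ∈ Ioo a b)
    (h₀₁ : θ₀ ≤ θ₁) (hL : L' < L) (p : ℕ) :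
    moment (Iic L') (fun x : ℝ => (x + θ₀ * Complex.I : ℂ)) D p +
      Complex.I • moment (Ioc θ₀ θ₁) (fun y : ℝ => (L' + y * Complex.I : ℂ)) D p +
      moment (Ioo L' L) (fun x : ℝ => (x + θ₁ * Complex.I : ℂ)) D p =
      moment (Iio L) (fun x : ℝ => (x + θ₁ * Complex.I : ℂ)) D p := by
  have hdec : HasDecay (fun ζ => Complex.exp (-(p * ζ)) • D ζ) (logStrip a b L) := by
    obtain ⟨C, A, hC, hA, hflat⟩ := hflat
    refine ⟨C * A ^ p * m p, 0, fun ζ hζ _ => ?_⟩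
    rw [norm_smul, Complex.norm_exp]
    calc _ ≤ Real.exp (-(p * ζ)).re *
          (C * A ^ p * m p * Real.exp (p * ζ.re) * Real.exp ζ.re) := by
          gcongr
          exact hflat p ζ hζ
      _ = C * A ^ p * m p * Real.exp ζ.re * (Real.exp (-(p * ζ)).re * Real.exp (p * ζ.re)) := by
          ring
      _ = _ := by rw [← Real.exp_add]; simp
  have h := integral_boundary_halfStrip (DifferentiableOn.smul (by fun_prop) hD) hdec hθ₀ hθ₁ h₀₁ hL
  rw [intervalIntegral.integral_of_le h₀₁] at h
  have hsplit : moment (Iio L) (fun x : ℝ => (x + θ₁ * Complex.I : ℂ)) D p =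
      moment (Iic L') (fun x : ℝ => (x + θ₁ * Complex.I : ℂ)) D p +
      moment (Ioo L' L) (fun x : ℝ => (x + θ₁ * Complex.I : ℂ)) D p := by
    simp only [moment]
    rw [← Iic_union_Ioo_eq_Iio hL]
    refine MeasureTheory.setIntegral_union ?_ measurableSet_Ioo
      ((isPath_ray hθ₁ measurableSet_Iic (Iic_subset_Iio.2 hL)).integrable_moment hD.continuousOn
        hflat p)
      ((isPath_ray hθ₁ measurableSet_Ioo Ioo_subset_Iio_self).integrable_moment hD.continuousOn
        hflat p)
    exact disjoint_left.2 fun x hx hx' => not_lt.2 hx hx'.1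
  rw [hsplit]
  exact congrArg (· + _) h

lemma bentTransform_unifExp (hm : ∀ n, 0 ≤ m n) (hD : DifferentiableOn ℂ D (logStrip a b L))
    (hflat : IsFlat m D (logStrip a b L)) (hθ₀ : θ₀ ∈ Ioo a b) (hθ₁ : θ₁ ∈ Ioo a b)
    (h₀₁ : θ₀ ≤ θ₁) (hL : L' < L) {η δ : ℝ} (h0 : 0 < η) (h1 : η < Real.pi) (hδ : 0 < δ) :
    UnifExp m (rayMoment L θ₁ D) (bentTransform L L' θ₀ θ₁ D)
      (awayFrom θ₀ η ∩ {w | w.re ≤ L' - δ}) := by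
  have hδ1 := one_sub_exp_neg_pos hδ
  have hDc := hD.continuousOn
  have h := (((((isPath_ray hθ₀ measurableSet_Iic (Iic_subset_Iio.2 hL)).unifExp hm hDc hflat
    (W := awayFrom θ₀ η ∩ {w | w.re ≤ L' - δ})
    (sin_half_pos h0 h1) fun w hw t _ => awayFrom_kernel h0 hw.1 t)).add hm
    (((isPath_segment hθ₀ hθ₁ hL).unifExp hm hDc hflat hδ1
      fun w hw t _ => left_kernel hw.2 (by simp)).const_smul hm Complex.I)).add hm
    ((isPath_ray hθ₁ measurableSet_Ioo Ioo_subset_Iio_self).unifExp hm hDc hflat hδ1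
      fun w hw t ht => left_kernel hw.2 (by simpa using ht.1.le))).const_smul hm
      (2 * Real.pi * Complex.I)⁻¹
  simp only [moment_eq_of_halfStrip hD hflat hθ₀ hθ₁ h₀₁ hL] at h
  exact h

lemma rayTransform_split (hD : ContinuousOn D (logStrip a b L))
    (hflat : IsFlat m D (logStrip a b L)) (hθ : θ ∈ Ioo a b) (hL : L' < L) {w : ℂ}
    (h0 : 0 < |w.im - θ|) (h1 : |w.im - θ| < 2 * Real.pi) :
    cauchyTransform (Iio L) (fun x : ℝ => (x + θ * Complex.I : ℂ)) D w =
      cauchyTransform (Iic L') (fun x : ℝ => (x + θ * Complex.I : ℂ)) D w +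
      cauchyTransform (Ioo L' L) (fun x : ℝ => (x + θ * Complex.I : ℂ)) D w := by
  obtain ⟨η, hη, hη', hn⟩ := exists_awayFrom_mem_nhds h0 h1
  have hw := mem_of_mem_nhds hn
  simp only [cauchyTransform]
  rw [← Iic_union_Ioo_eq_Iio hL]
  refine MeasureTheory.setIntegral_union ?_ measurableSet_Ioo
    ((isPath_ray hθ measurableSet_Iic (Iic_subset_Iio.2 hL)).integrable_cauchyTransform hD
      hflat (sin_half_pos hη hη') fun t _ => awayFrom_kernel hη hw t)
    ((isPath_ray hθ measurableSet_Ioo Ioo_subset_Iio_self).integrable_cauchyTransform hD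
      hflat (sin_half_pos hη hη') fun t _ => awayFrom_kernel hη hw t)
  exact disjoint_left.2 fun x hx hx' => not_lt.2 hx hx'.1

omit [NormedSpace ℂ E] in
lemma IsFlat.exists_norm_le (hm : ∀ n, 0 ≤ m n) (hflat : IsFlat m D (logStrip a b L)) :
    ∃ B, ∀ ζ ∈ logStrip a b L, ‖D ζ‖ ≤ B := by
  obtain ⟨C, A, hC, hA, hflat⟩ := hflat
  refine ⟨C * m 0 * Real.exp L, fun ζ hζ => (hflat 0 ζ hζ).trans ?_⟩
  have := hm 0
  simp only [pow_zero, mul_one, CharP.cast_eq_zero, zero_mul, Real.exp_zero]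
  gcongr
  exact hζ.1.le

/-- No pole of the kernel lies in the region between the straight and the bent path. -/
lemma bentTransform_eq_of_gt (hm : ∀ n, 0 ≤ m n) (hD : DifferentiableOn ℂ D (logStrip a b L))
    (hflat : IsFlat m D (logStrip a b L)) (hθ₀ : θ₀ ∈ Ioo a b) (hθ₁ : θ₁ ∈ Ioo a b)
    (h₀₁ : θ₀ ≤ θ₁) (hL : L' < L) {w : ℂ} (hw₁ : θ₁ < w.im) (hw₀ : w.im < θ₀ + 2 * Real.pi) :
    bentTransform L L' θ₀ θ₁ D w = rayTransform L θ₁ D w := by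
  obtain ⟨B, hB⟩ := hflat.exists_norm_le hm
  have h := integral_boundary_kernel_smul_of_notMem hD hB hθ₀ hθ₁ h₀₁ hL hw₁ hw₀
  rw [intervalIntegral.integral_of_le h₀₁] at h
  have ha : |w.im - θ₁| = w.im - θ₁ := abs_of_pos (by linarith)
  rw [rayTransform, rayTransform_split hD.continuousOn hflat hθ₁ hL (by rw [ha]; linarith)
    (by rw [ha]; linarith), bentTransform]
  congr 1
  exact congrArg (· + _) h

/-- Now the pole `w` lies between the two paths and contributes its residue `D w`. -/
lemma bentTransform_eq_of_lt [CompleteSpace E] (hm : ∀ n, 0 ≤ m n) (hab : b ≤ a + 2 * Real.pi)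
    (hD : DifferentiableOn ℂ D (logStrip a b L))
    (hflat : IsFlat m D (logStrip a b L)) (hθ₀ : θ₀ ∈ Ioo a b) (hθ₁ : θ₁ ∈ Ioo a b)
    (hpi : θ₁ - θ₀ ≤ Real.pi) (hL : L' < L) {w : ℂ} (hw : w.re < L') (hw₀ : θ₀ < w.im)
    (hw₁ : w.im < θ₁) :
    bentTransform L L' θ₀ θ₁ D w = rayTransform L θ₁ D w + D w := by
  obtain ⟨B, hB⟩ := hflat.exists_norm_le hm
  have h := integral_boundary_kernel_smul_of_mem hD hB hab hθ₀ hθ₁ hL hw₀ hw₁ hpi hw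
  rw [intervalIntegral.integral_of_le (by linarith)] at h
  have ha : |w.im - θ₁| = θ₁ - w.im := by rw [abs_sub_comm]; exact abs_of_pos (by linarith)
  have hpi' := Real.pi_pos
  have hne : (2 * Real.pi * Complex.I : ℂ) ≠ 0 := Complex.two_pi_I_ne_zero
  rw [rayTransform, rayTransform_split hD.continuousOn hflat hθ₁ hL (by rw [ha]; linarith)
    (by rw [ha]; linarith), bentTransform]
  have h' := congrArg (fun v => (2 * Real.pi * Complex.I : ℂ)⁻¹ • (v +
    cauchyTransform (Ioo L' L) (fun x : ℝ => (x + θ₁ * Complex.I : ℂ)) D w)) h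
  refine h'.trans ?_
  rw [add_right_comm, smul_add _ _ (_ • D w), smul_smul, inv_mul_cancel₀ hne, one_smul]
  rfl

end

/-! ### Analytic continuation across the ray and the Cauchy–Heine theorem -/

/-- The Cauchy–Heine integral along the ray of argument `θ₁`, continued analytically downwards
across this ray. -/
noncomputable def continuedTransform (L θ₀ θ₁ : ℝ) (D : ℂ → E) (w : ℂ) : E :=
  if w.im < θ₁ then rayTransform L θ₁ D w + D w
  -- On the ray itself every bending modulus between `w.re` and `L` gives the same value; the
  -- midpoint is one choice.
  else if w.im = θ₁ then bentTransform L ((w.re + L) / 2) θ₀ θ₁ D w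
  else rayTransform L θ₁ D w

section

variable [CompleteSpace E] {D : ℂ → E} {m : ℕ → ℝ} {a b L θ₀ θ₁ : ℝ}

/-- Identifies the three cases of the definition, near the ray, with a single holomorphic function,
the bent integral with a fixed `L'`. -/
lemma continuedTransform_eq_bentTransform (hm : ∀ n, 0 ≤ m n) (hab : b ≤ a + 2 * Real.pi)
    (hD : DifferentiableOn ℂ D (logStrip a b L)) (hflat : IsFlat m D (logStrip a b L))
    (hθ₀ : θ₀ ∈ Ioo a b) (hθ₁ : θ₁ ∈ Ioo a b) (h₀₁ : θ₀ ≤ θ₁) (hpi : θ₁ - θ₀ ≤ Real.pi)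
    {L' : ℝ} (hL : L' < L) {w : ℂ} (hw : w.re < L') (hw₀ : θ₀ < w.im)
    (hw₁ : w.im < θ₀ + 2 * Real.pi) :
    continuedTransform L θ₀ θ₁ D w = bentTransform L L' θ₀ θ₁ D w := by
  rw [continuedTransform]
  rcases lt_trichotomy w.im θ₁ with h | h | h
  · rw [if_pos h, bentTransform_eq_of_lt hm hab hD hflat hθ₀ hθ₁ hpi hL hw hw₀ h]
  · rw [if_neg h.not_lt, if_pos h]
    have hre : w.re < (w.re + L) / 2 := by linarith
    have hreL : (w.re + L) / 2 < L := by linarith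
    have hpath : Tendsto (fun t : ℝ => w + t * Complex.I) (𝓝[>] 0) (𝓝 w) := by
      have : Tendsto (fun t : ℝ => w + t * Complex.I) (𝓝 0) (𝓝 (w + (0 : ℝ) * Complex.I)) :=
        (Continuous.tendsto (by fun_prop) 0)
      simp only [Complex.ofReal_zero, zero_mul, add_zero] at this
      exact this.mono_left nhdsWithin_le_nhds
    -- On the ray, each bent integral is the limit of the same straight integral from above, so it
    -- does not depend on the bending modulus.
    have hlim : ∀ M, M < L → w.re < M →
        Tendsto (fun t : ℝ => rayTransform L θ₁ D (w + t * Complex.I)) (𝓝[>] 0)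
        (𝓝 (bentTransform L M θ₀ θ₁ D w)) := fun M h1 h2 => by
      have ha : |w.im - θ₀| = w.im - θ₀ := abs_of_pos (by linarith)
      have hc := (bentTransform_differentiableAt hD.continuousOn hflat hθ₀ hθ₁ h1 h2
        (by rw [ha]; linarith) (by rw [ha]; linarith)).continuousAt.tendsto.comp hpath
      refine hc.congr' ?_
      have hsmall : ∀ᶠ t : ℝ in 𝓝[>] 0, t < θ₀ + 2 * Real.pi - w.im :=
        nhdsWithin_le_nhds (gt_mem_nhds (by linarith))
      filter_upwards [hsmall, self_mem_nhdsWithin] with t ht ht0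
      rw [mem_Ioi] at ht0
      exact bentTransform_eq_of_gt hm hD hflat hθ₀ hθ₁ h₀₁ h1 (by simp; linarith)
        (by simp; linarith)
    exact tendsto_nhds_unique (hlim _ hreL hre) (hlim _ hL hw)
  · rw [if_neg h.not_gt, if_neg h.ne', bentTransform_eq_of_gt hm hD hflat hθ₀ hθ₁ h₀₁ hL h hw₁]

lemma continuedTransform_differentiableAt (hm : ∀ n, 0 ≤ m n) (hab : b ≤ a + 2 * Real.pi)
    (hD : DifferentiableOn ℂ D (logStrip a b L)) (hflat : IsFlat m D (logStrip a b L))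
    (hθ₀ : θ₀ ∈ Ioo a b) (hθ₁ : θ₁ ∈ Ioo a b) (h₀₁ : θ₀ < θ₁) (hpi : θ₁ - θ₀ ≤ Real.pi)
    {w : ℂ} (hw : w ∈ logStrip a (θ₁ + 2 * Real.pi) L) :
    DifferentiableAt ℂ (continuedTransform L θ₀ θ₁ D) w := by
  obtain ⟨hwL, hwa, hwb⟩ := hw
  have hpi' := Real.pi_pos
  rcases lt_trichotomy w.im θ₁ with h | h | h
  · have ha : |w.im - θ₁| = θ₁ - w.im := by rw [abs_sub_comm]; exact abs_of_pos (by linarith)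
    have hd1 := rayTransform_differentiableAt hD.continuousOn hflat hθ₁ (w := w)
      (by rw [ha]; linarith) (by rw [ha]; linarith [hθ₁.2])
    have hd2 := hD.differentiableAt ((isOpen_logStrip a b L).mem_nhds
      ⟨hwL, hwa, h.trans hθ₁.2⟩)
    refine (hd1.add hd2).congr_of_eventuallyEq ?_
    filter_upwards [Complex.continuous_im.continuousAt.eventually (gt_mem_nhds h)] with v hv
    exact if_pos hv
  · obtain ⟨L', hL', hL⟩ := exists_between hwL
    have hbd : θ₁ < θ₀ + 2 * Real.pi := by linarith
    have ha : |w.im - θ₀| = w.im - θ₀ := abs_of_pos (by linarith)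
    refine (bentTransform_differentiableAt hD.continuousOn hflat hθ₀ hθ₁ hL hL'
      (by rw [ha]; linarith) (by rw [ha]; linarith)).congr_of_eventuallyEq ?_
    filter_upwards [(isOpen_logStrip θ₀ (θ₀ + 2 * Real.pi) L').mem_nhds
      (show w ∈ _ from ⟨hL', by linarith, by linarith⟩)] with v hv
    exact continuedTransform_eq_bentTransform hm hab hD hflat hθ₀ hθ₁ h₀₁.le hpi hL hv.1 hv.2.1
      hv.2.2
  · have ha : |w.im - θ₁| = w.im - θ₁ := abs_of_pos (by linarith)
    refine (rayTransform_differentiableAt hD.continuousOn hflat hθ₁ (w := w)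
      (by rw [ha]; linarith) (by rw [ha]; linarith)).congr_of_eventuallyEq ?_
    filter_upwards [Complex.continuous_im.continuousAt.eventually (lt_mem_nhds h)] with v hv
    rw [continuedTransform, if_neg (not_lt.2 (le_of_lt hv)), if_neg (ne_of_gt hv)]

/-- Away from the ray the straight integral is used, with the flat `D` added below it; around the
ray the bent one. All have the same coefficients. The upper limit `θ₀ + 2π` keeps away from the next
translate `θ₁ + 2π` of the ray. -/
lemma continuedTransform_unifExp (hm : ∀ n, 0 ≤ m n) (hab : b ≤ a + 2 * Real.pi)
    (hD : DifferentiableOn ℂ D (logStrip a b L)) (hflat : IsFlat m D (logStrip a b L))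
    (hθ₀ : θ₀ ∈ Ioo a b) (hθ₁ : θ₁ ∈ Ioo a b) (h₀₁ : θ₀ < θ₁) (hpi : θ₁ - θ₀ ≤ Real.pi)
    {L'' : ℝ} (hL'' : L'' < L) :
    UnifExp m (rayMoment L θ₁ D) (continuedTransform L θ₀ θ₁ D)
      (logStrip a (θ₀ + 2 * Real.pi) L'') := by
  obtain ⟨L', h1, h2⟩ := exists_between hL''
  have hpi' := Real.pi_pos
  -- One distance for all three regions: half of `θ₁ - θ₀` separates the middle argument from both
  -- rays, while `b - θ₁` and `θ₀ - a` keep clear of their translates by `∓2π`, because `b - a ≤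
  -- 2π`.
  obtain ⟨η, hη0, hη⟩ : ∃ η : ℝ, 0 < η ∧ η < Real.pi ∧ η ≤ (θ₁ - θ₀) / 2 ∧ η ≤ b - θ₁ ∧
      η ≤ θ₀ - a := by
    refine ⟨min (min (Real.pi / 2) ((θ₁ - θ₀) / 2)) (min (b - θ₁) (θ₀ - a)), ?_, ?_, ?_, ?_, ?_⟩
    · exact lt_min (lt_min (by linarith) (by linarith))
        (lt_min (by linarith [hθ₁.2]) (by linarith [hθ₀.1]))
    · exact ((min_le_left _ _).trans (min_le_left _ _)).trans_lt (by linarith)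
    · exact (min_le_left _ _).trans (min_le_right _ _)
    · exact (min_le_right _ _).trans (min_le_left _ _)
    · exact (min_le_right _ _).trans (min_le_right _ _)
  obtain ⟨hηpi, hη1, hη2, hη3⟩ := hη
  have hDc := hD.continuousOn
  have hR := rayTransform_unifExp hm hDc hflat hθ₁ hη0 hηpi
  have hB := bentTransform_unifExp hm hD hflat hθ₀ hθ₁ h₀₁.le h2 hη0 hηpi (sub_pos.2 h1)
  have u1 : UnifExp m (rayMoment L θ₁ D) (continuedTransform L θ₀ θ₁ D)
      (logStrip a ((θ₀ + θ₁) / 2) L'') := by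
    have hDu := hflat.unifExp hm (fun w hw => hw.1.le)
    have h3 := (hR.mono (W' := logStrip a ((θ₀ + θ₁) / 2) L'') fun w hw => ?_).add hm
      (hDu.mono (W' := logStrip a ((θ₀ + θ₁) / 2) L'') fun w hw =>
        ⟨hw.1.trans hL'', hw.2.1, hw.2.2.trans (by linarith [hθ₁.2])⟩)
    · simp only [add_zero] at h3
      refine h3.congr fun w hw => if_pos (hw.2.2.trans (by linarith))
    · have ha : |w.im - θ₁| = θ₁ - w.im := by
        rw [abs_sub_comm]; exact abs_of_pos (by linarith [hw.2.2])
      exact ⟨by rw [ha]; linarith [hw.2.2], by rw [ha]; linarith [hw.2.1]⟩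
  have u2 : UnifExp m (rayMoment L θ₁ D) (continuedTransform L θ₀ θ₁ D)
      {w | w.re < L'' ∧ (θ₀ + θ₁) / 2 ≤ w.im ∧ w.im < b} := by
    refine (hB.mono fun w hw => ?_).congr fun w hw =>
      continuedTransform_eq_bentTransform hm hab hD hflat hθ₀ hθ₁ h₀₁.le hpi h2 (hw.1.trans h1)
      (by linarith [hw.2.1]) (by linarith [hw.2.2, hθ₀.1])
    have ha : |w.im - θ₀| = w.im - θ₀ := abs_of_pos (by linarith [hw.2.1])
    exact ⟨⟨by rw [ha]; linarith [hw.2.1], by rw [ha]; linarith [hw.2.2]⟩,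
      by simpa using hw.1.le⟩
  have u3 : UnifExp m (rayMoment L θ₁ D) (continuedTransform L θ₀ θ₁ D)
      {w | w.re < L'' ∧ b ≤ w.im ∧ w.im < θ₀ + 2 * Real.pi} := by
    refine (hR.mono fun w hw => ?_).congr fun w hw => ?_
    · have ha : |w.im - θ₁| = w.im - θ₁ := abs_of_pos (by linarith [hw.2.1, hθ₁.2])
      exact ⟨by rw [ha]; linarith [hw.2.1], by rw [ha]; linarith [hw.2.2]⟩
    · have : θ₁ < w.im := hθ₁.2.trans_le hw.2.1
      rw [continuedTransform, if_neg this.not_gt, if_neg this.ne']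
  refine ((u1.union hm u2).union hm u3).mono fun w hw => ?_
  rcases lt_or_ge w.im ((θ₀ + θ₁) / 2) with h | h
  · exact Or.inl (Or.inl ⟨hw.1, hw.2.1, h⟩)
  · rcases lt_or_ge w.im b with h' | h'
    · exact Or.inl (Or.inr ⟨hw.1, h, h'⟩)
    · exact Or.inr ⟨hw.1, h', hw.2.2⟩

/-- **Cauchy–Heine theorem**: a flat function on a sector is the difference of the two
determinations of a function on a sector with opening larger by `2π`, which has an asymptotic
expansion. -/
theorem exists_sub_add_period_eq (hm : ∀ n, 0 ≤ m n) (hab : a < b) (hab' : b ≤ a + 2 * Real.pi)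
    (hD : DifferentiableOn ℂ D (logStrip a b L)) (hflat : IsFlat m D (logStrip a b L)) :
    ∃ (c : ℕ → E) (Ψ : ℂ → E), DifferentiableOn ℂ Ψ (logStrip a (b + 2 * Real.pi) L) ∧
      (∀ w ∈ logStrip a b L, Ψ w - Ψ (w + 2 * Real.pi * Complex.I) = D w) ∧
      ∀ L' < L, UnifExp m c Ψ (logStrip a (b + 2 * Real.pi) L') := by
  -- The two arguments cut `(a, b)` into thirds, so that `θ₁ - θ₀ ≤ 2π / 3 < π`.
  obtain ⟨θ₀, hθ₀⟩ : ∃ θ₀, θ₀ = (2 * a + b) / 3 := ⟨_, rfl⟩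
  obtain ⟨θ₁, hθ₁⟩ : ∃ θ₁, θ₁ = (a + 2 * b) / 3 := ⟨_, rfl⟩
  have hpi' := Real.pi_pos
  have h₀ : θ₀ ∈ Ioo a b := ⟨by linarith, by linarith⟩
  have h₁ : θ₁ ∈ Ioo a b := ⟨by linarith, by linarith⟩
  have h₀₁ : θ₀ < θ₁ := by linarith
  have hpi : θ₁ - θ₀ ≤ Real.pi := by linarith
  set P := continuedTransform L θ₀ θ₁ D
  have hPd : ∀ w ∈ logStrip a (θ₁ + 2 * Real.pi) L, DifferentiableAt ℂ P w := fun w hw =>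
    continuedTransform_differentiableAt hm hab' hD hflat h₀ h₁ h₀₁ hpi hw
  have hPlt : ∀ w : ℂ, w.im < θ₁ → P w = rayTransform L θ₁ D w + D w := fun w hw => if_pos hw
  have hPgt : ∀ w : ℂ, θ₁ < w.im → P w = rayTransform L θ₁ D w := fun w hw => by
    simp only [P]
    rw [continuedTransform, if_neg hw.not_gt, if_neg hw.ne']
  have hper := rayTransform_add_period L θ₁ D
  set T : ℂ := 2 * Real.pi * Complex.I
  have hTim : T.im = 2 * Real.pi := by simp [T]
  have hTre : T.re = 0 := by simp [T]
  -- `Q` is forced by the functional equation and continues `P` beyond `θ₁ + 2π`. They agree for `a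
  -- + 2π < Im w < θ₁ + 2π`, since `P - D` below the ray is the periodic straight integral; the two
  -- are joined at `θ₀ + 2π`, inside this range.
  set Q : ℂ → E := fun w => P (w - T) - D (w - T)
  have hQd : ∀ w, w - T ∈ logStrip a b L → DifferentiableAt ℂ Q w := fun w hw => by
    have hin : DifferentiableAt ℂ (fun w => w - T) w := by fun_prop
    have h1 := hPd (w - T) ⟨hw.1, hw.2.1, hw.2.2.trans (by linarith [h₁.1])⟩
    have h2 := hD.differentiableAt ((isOpen_logStrip a b L).mem_nhds hw)
    exact (h1.comp w hin).sub (h2.comp w hin)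
  have hPQ : ∀ w : ℂ, a + 2 * Real.pi < w.im → w.im < θ₁ + 2 * Real.pi → P w = Q w := by
    intro w h1 h2
    simp only [Q]
    rw [hPgt w (by linarith [h₁.2]), hPlt (w - T) (by simp [hTim]; linarith), add_sub_cancel_right,
      ← hper (w - T), sub_add_cancel]
  refine ⟨rayMoment L θ₁ D, fun w => if w.im < θ₀ + 2 * Real.pi then P w else Q w,
    fun w hw => ?_, fun w hw => ?_, fun L' hL' => ?_⟩
  · refine DifferentiableAt.differentiableWithinAt ?_
    rcases lt_or_ge w.im (θ₀ + 2 * Real.pi) with h | h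
    · refine (hPd w ⟨hw.1, hw.2.1, by linarith⟩).congr_of_eventuallyEq ?_
      filter_upwards [Complex.continuous_im.continuousAt.eventually (gt_mem_nhds h)] with v hv
      exact if_pos hv
    · have hlow : a + 2 * Real.pi < w.im := by linarith [h₀.1]
      refine (hQd w ⟨by simp [hTre, hw.1], by simp [hTim]; linarith,
        by simp [hTim]; linarith [hw.2.2]⟩).congr_of_eventuallyEq ?_
      filter_upwards [Complex.continuous_im.continuousAt.eventually (lt_mem_nhds hlow)] with v hv
      split_ifs with hc
      · exact hPQ v hv (by linarith)
      · rfl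
  · have hw2 := hw.2.2
    have hw1 := hw.2.1
    have e1 : w.im < θ₀ + 2 * Real.pi := by linarith [h₀.1]
    simp only [if_pos e1]
    have e2 : (w + T).im = w.im + 2 * Real.pi := by simp [hTim]
    split_ifs with hc
    · rw [e2] at hc
      rw [hPlt w (by linarith), hPgt (w + T) (by rw [e2]; linarith [h₁.2]), hper,
        add_sub_cancel_left]
    · simp only [Q, add_sub_cancel_right, sub_sub_cancel]
  · have hP := continuedTransform_unifExp hm hab' hD hflat h₀ h₁ h₀₁ hpi hL'
    have hDu := (hflat.unifExp hm (fun w hw => hw.1.le)).const_smul hm (-1)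
    have hsub : logStrip a b L' ⊆ logStrip a b L := fun w hw => ⟨hw.1.trans hL', hw.2⟩
    have hPD := ((hP.mono (W' := logStrip a b L') fun w hw =>
      ⟨hw.1, hw.2.1, by linarith [hw.2.2, h₀.1]⟩).add hm (hDu.mono hsub)).comp_add (-1)
    simp only [smul_zero, add_zero] at hPD
    refine ((hP.congr fun w hw => if_pos hw.2.2).union hm ((hPD.mono
      (W' := {w | w.re < L' ∧ θ₀ + 2 * Real.pi ≤ w.im ∧ w.im < b + 2 * Real.pi})
      fun w hw => ?_).congr fun w hw => ?_)).mono fun w hw => ?_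
    · refine ⟨by simpa using hw.1, ?_, ?_⟩
      · simp; linarith [hw.2.1, h₀.1]
      · simp; linarith [hw.2.2]
    · have hn : ¬ w.im < θ₀ + 2 * Real.pi := not_lt.2 hw.2.1
      simp only [if_neg hn, Q, T]
      push_cast
      simp only [neg_mul, one_mul, ← sub_eq_add_neg, neg_smul, one_smul]
      rfl
    · rcases lt_or_ge w.im (θ₀ + 2 * Real.pi) with h | h
      · exact Or.inl ⟨hw.1, hw.2.1, h⟩
      · exact Or.inr ⟨hw.1, h, hw.2.2⟩

end

/-! ### Splitting flat cocycles on a good covering -/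

namespace GoodCovering

variable {ν : ℕ} (𝒞 : GoodCovering ν)

lemma period_pos {ν : ℕ} (𝒞 : GoodCovering ν) : 0 < ν := by
  rcases Nat.eq_zero_or_pos ν with rfl | h
  · have := 𝒞.lower_add_period 0
    simp at this
  · exact h

lemma lower_add_mul_period (i q : ℤ) :
    𝒞.lower (i + q * ν) = 𝒞.lower i + q * (2 * Real.pi) := by
  induction q using Int.induction_on with
  | zero => simp
  | succ n ih =>
    rw [show i + ((n : ℤ) + 1) * ν = i + n * ν + ν by ring, 𝒞.lower_add_period, ih]
    push_cast
    ring
  | pred n ih =>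
    have := 𝒞.lower_add_period (i + (-(n : ℤ) - 1) * ν)
    rw [show i + (-(n : ℤ) - 1) * ν + ν = i + -(n : ℤ) * ν by ring, ih] at this
    push_cast at this ⊢
    linarith

lemma upper_add_mul_period (i q : ℤ) :
    𝒞.upper (i + q * ν) = 𝒞.upper i + q * (2 * Real.pi) := by
  induction q using Int.induction_on with
  | zero => simp
  | succ n ih =>
    rw [show i + ((n : ℤ) + 1) * ν = i + n * ν + ν by ring, 𝒞.upper_add_period, ih]
    push_cast
    ring
  | pred n ih =>
    have := 𝒞.upper_add_period (i + (-(n : ℤ) - 1) * ν)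
    rw [show i + (-(n : ℤ) - 1) * ν + ν = i + -(n : ℤ) * ν by ring, ih] at this
    push_cast at this ⊢
    linarith

/-- The sector `𝓔 i` in the logarithmic coordinate, up to real part `L`. -/
def strip (𝒞 : GoodCovering ν) (i : ℤ) (L : ℝ) : Set ℂ := logStrip (𝒞.lower i) (𝒞.upper i) L

/-- The overlap of the strips of two consecutive sectors. -/
def overlapStrip (𝒞 : GoodCovering ν) (i : ℤ) (L : ℝ) : Set ℂ :=
  logStrip (𝒞.lower (i + 1)) (𝒞.upper i) L

end GoodCovering

lemma apply_add_mul_period {X : Type*} {ν : ℕ} {H : ℤ → ℂ → X}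
    (hH : ∀ i w, H (i + ν) (w + 2 * Real.pi * Complex.I) = H i w) (i q : ℤ) (w : ℂ) :
    H (i + q * ν) (w + q * (2 * Real.pi * Complex.I)) = H i w := by
  induction q using Int.induction_on generalizing w with
  | zero => simp
  | succ n ih =>
    rw [← ih, ← hH (i + n * ν)]
    congr 1
    · ring
    · push_cast; ring
  | pred n ih =>
    rw [← ih, ← hH (i + (-(n : ℤ) - 1) * ν)]
    congr 1
    · ring
    · push_cast; ring

section

variable [CompleteSpace E] {ν : ℕ} (𝒞 : GoodCovering ν) {m : ℕ → ℝ} {L : ℝ} {D : ℤ → ℂ → E}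

/-- The Cauchy–Heine theorem is used only for the representatives `i % ν`, and the result is
translated to the other indices. Independent choices for `i` and `i + ν` would spoil the telescoping
in `exists_splitting`. -/
lemma exists_periodic_cauchyHeine (hm : ∀ n, 0 ≤ m n)
    (hD : ∀ i, DifferentiableOn ℂ (D i) (𝒞.overlapStrip i L))
    (hflat : ∀ i, IsFlat m (D i) (𝒞.overlapStrip i L))
    (hper : ∀ i w, D (i + ν) (w + 2 * Real.pi * Complex.I) = D i w) :
    ∃ (c : ℤ → ℕ → E) (Ψ : ℤ → ℂ → E),
      (∀ i, DifferentiableOn ℂ (Ψ i)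
        (logStrip (𝒞.lower (i + 1)) (𝒞.upper i + 2 * Real.pi) L)) ∧
      (∀ i, ∀ w ∈ 𝒞.overlapStrip i L, Ψ i w - Ψ i (w + 2 * Real.pi * Complex.I) = D i w) ∧
      (∀ i, ∀ L' < L, UnifExp m (c i) (Ψ i)
        (logStrip (𝒞.lower (i + 1)) (𝒞.upper i + 2 * Real.pi) L')) ∧
      (∀ i, c (i + ν) = c i) ∧
      ∀ i w, Ψ (i + ν) (w + 2 * Real.pi * Complex.I) = Ψ i w := by
  have hν := 𝒞.period_pos
  have hν0 : (ν : ℤ) ≠ 0 := by exact_mod_cast hν.ne'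
  have hex : ∀ i, ∃ (c : ℕ → E) (Ψ : ℂ → E), DifferentiableOn ℂ Ψ
      (logStrip (𝒞.lower (i + 1)) (𝒞.upper i + 2 * Real.pi) L) ∧
      (∀ w ∈ 𝒞.overlapStrip i L, Ψ w - Ψ (w + 2 * Real.pi * Complex.I) = D i w) ∧
      ∀ L' < L, UnifExp m c Ψ (logStrip (𝒞.lower (i + 1)) (𝒞.upper i + 2 * Real.pi) L') := fun i =>
    exists_sub_add_period_eq hm (𝒞.overlap i)
      ((𝒞.upper_le i).trans (by linarith [𝒞.lower_mono (show i ≤ i + 1 by lia)])) (hD i) (hflat i)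
  choose c Ψ hΨd hΨD hΨu using hex
  have hl : ∀ i : ℤ, 𝒞.lower (i + 1) =
      𝒞.lower (i % ν + 1) + (i / ν : ℤ) * (2 * Real.pi) := fun i => by
    rw [← 𝒞.lower_add_mul_period]
    congr 1
    have := Int.emod_add_ediv_mul i ν
    lia
  have hu : ∀ i : ℤ, 𝒞.upper i = 𝒞.upper (i % ν) + (i / ν : ℤ) * (2 * Real.pi) := fun i => by
    rw [← 𝒞.upper_add_mul_period, Int.emod_add_ediv_mul]
  have hstrip : ∀ (i : ℤ) (M : ℝ) (w : ℂ),
      w ∈ logStrip (𝒞.lower (i + 1)) (𝒞.upper i + 2 * Real.pi) M →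
      w + (-(i / ν) : ℤ) * (2 * Real.pi * Complex.I) ∈
        logStrip (𝒞.lower (i % ν + 1)) (𝒞.upper (i % ν) + 2 * Real.pi) M := fun i M w hw => by
    obtain ⟨h1, h2, h3⟩ := hw
    rw [hl] at h2
    rw [hu] at h3
    refine ⟨by simpa using h1, ?_, ?_⟩
    · simp; linarith
    · simp; linarith
  refine ⟨fun i => c (i % ν),
    fun i w => Ψ (i % ν) (w + (-(i / ν) : ℤ) * (2 * Real.pi * Complex.I)),
    fun i => ?_, fun i w hw => ?_, fun i L' hL' => ?_, fun i => ?_, fun i w => ?_⟩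
  · exact (hΨd (i % ν)).comp (by fun_prop) fun w hw => hstrip i L w hw
  · obtain ⟨h1, h2, h3⟩ := hw
    rw [hl] at h2
    rw [hu] at h3
    have h := hΨD (i % ν) (w + (-(i / ν) : ℤ) * (2 * Real.pi * Complex.I))
      ⟨by simpa using h1, by simp; linarith, by simp; linarith⟩
    have hp := apply_add_mul_period hper (i % ν) (i / ν)
      (w + (-(i / ν) : ℤ) * (2 * Real.pi * Complex.I))
    rw [← hp, Int.emod_add_ediv_mul] at h
    dsimp only
    rw [add_right_comm w (2 * _ * _), h]
    congr 1
    push_cast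
    ring
  · exact ((hΨu (i % ν) L' hL').comp_add _).mono fun w hw => hstrip i L' w hw
  · simp only [Int.add_emod_right]
  · simp only [Int.add_emod_right]
    rw [Int.add_ediv_of_dvd_right dvd_rfl, Int.ediv_self hν0]
    congr 1
    push_cast
    ring

/-- Splitting of a flat cocycle on a good covering into functions with a common expansion. -/
theorem exists_splitting (hm : ∀ n, 0 ≤ m n)
    (hD : ∀ i, DifferentiableOn ℂ (D i) (𝒞.overlapStrip i L))
    (hflat : ∀ i, IsFlat m (D i) (𝒞.overlapStrip i L))
    (hper : ∀ i w, D (i + ν) (w + 2 * Real.pi * Complex.I) = D i w) :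
    ∃ (c : ℕ → E) (H : ℤ → ℂ → E),
      (∀ k, DifferentiableOn ℂ (H k) (𝒞.strip k L)) ∧
      (∀ k, ∀ w ∈ 𝒞.overlapStrip k L, H (k + 1) w - H k w = D k w) ∧
      (∀ k w, H (k + ν) (w + 2 * Real.pi * Complex.I) = H k w) ∧
      ∀ k, ∀ L' < L, UnifExp m c (H k) (𝒞.strip k L') := by
  obtain ⟨c, Ψ, hΨd, hΨD, hΨu, hc, hΨp⟩ := exists_periodic_cauchyHeine 𝒞 hm hD hflat hper
  -- The inequalities `k - j ≤ k ≤ k - 1 - j + ν` and monotonicity of the endpoints place the `k`-th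
  -- strip in the domains of exactly the summands used.
  have hsub : ∀ (k : ℤ) (j : ℕ), j < ν → ∀ M, 𝒞.strip k M ⊆
      logStrip (𝒞.lower (k - 1 - j + 1)) (𝒞.upper (k - 1 - j) + 2 * Real.pi) M :=
    fun k j hj M w hw => ⟨hw.1, (𝒞.lower_mono (by lia)).trans_lt hw.2.1, by
      rw [← 𝒞.upper_add_period]
      exact hw.2.2.trans_le (𝒞.upper_mono (by lia))⟩
  -- The sum of a `ν`-periodic sequence over a full period does not depend on where the period
  -- starts.
  have hcs : ∀ k : ℤ, ∀ p, ∑ j ∈ Finset.range ν, c (k - 1 - j) p =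
      ∑ j ∈ Finset.range ν, c (-1 - j) p := by
    have hstep : ∀ k : ℤ, ∀ p, ∑ j ∈ Finset.range ν, c (k - j) p =
        ∑ j ∈ Finset.range ν, c (k - 1 - j) p := fun k p => by
      rw [← sub_eq_zero, ← Finset.sum_sub_distrib]
      have h := Finset.sum_range_sub' (fun j : ℕ => c (k - j) p) ν
      have h2 := congrFun (hc (k - ν)) p
      rw [sub_add_cancel] at h2
      simp only [Nat.cast_zero, sub_zero, h2, sub_self] at h
      rw [← h]
      refine Finset.sum_congr rfl fun j _ => ?_
      rw [show k - 1 - (j : ℤ) = k - ((j + 1 : ℕ) : ℤ) by push_cast; ring]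
    intro k p
    induction k using Int.induction_on with
    | zero => simp
    | succ n ih => 
      rw [← ih, ← hstep n]
      simp only [add_sub_cancel_right]
    | pred n ih => rw [← ih, ← hstep (-n - 1)]
  refine ⟨fun p => ∑ j ∈ Finset.range ν, c (-1 - j) p,
    fun k w => ∑ j ∈ Finset.range ν, Ψ (k - 1 - j) w, fun k => ?_, fun k w hw => ?_,
    fun k w => ?_, fun k L' hL' => ?_⟩
  · exact DifferentiableOn.fun_sum fun j hj =>
      (hΨd _).mono (hsub k j (Finset.mem_range.1 hj) L)
  · rw [← Finset.sum_sub_distrib]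
    -- Telescoping leaves `Ψ k - Ψ (k - ν)`, and `Ψ (k - ν)` at `w` is `Ψ k` at `w + 2πi`.
    have h := Finset.sum_range_sub' (fun j : ℕ => Ψ (k - j) w) ν
    have h2 := hΨp (k - ν) w
    rw [sub_add_cancel] at h2
    simp only [Nat.cast_zero, sub_zero] at h
    rw [← hΨD k w hw, h2, ← h]
    refine Finset.sum_congr rfl fun j _ => ?_
    rw [add_sub_cancel_right, show k - 1 - (j : ℤ) = k - ((j + 1 : ℕ) : ℤ) by push_cast; ring]
  · refine Finset.sum_congr rfl fun j _ => ?_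
    rw [← hΨp (k - 1 - j)]
    congr 1
    ring
  · have := UnifExp.finset_sum hm (Finset.range ν) (W := 𝒞.strip k L')
      (a := fun j => c (k - 1 - j)) (f := fun j => Ψ (k - 1 - j))
      fun j hj => (hΨu _ L' hL').mono (hsub k j (Finset.mem_range.1 hj) L')
    simp only [hcs] at this
    exact this

end

/-- Functions on the strips which agree on consecutive overlaps agree on all overlaps. -/
lemma eqOn_strip_inter {X : Type*} {ν : ℕ} (𝒞 : GoodCovering ν) {L : ℝ} {H : ℤ → ℂ → X} {p q : ℤ}
    (hH : ∀ k ∈ Ico p q, ∀ w ∈ 𝒞.overlapStrip k L, H (k + 1) w = H k w)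
    {j k : ℤ} (hj : j ∈ Icc p q) (hk : k ∈ Icc p q) {w : ℂ} (hwj : w ∈ 𝒞.strip j L)
    (hwk : w ∈ 𝒞.strip k L) : H j w = H k w := by
  wlog hjk : j ≤ k generalizing j k
  · exact (this hk hj hwk hwj (le_of_not_ge hjk)).symm
  induction k, hjk using Int.leInduction with
  | base => rfl
  | succ k hle ih =>
    -- As the endpoints are monotone, a point of two strips lies in all strips between them.
    have hk' : w ∈ 𝒞.strip k L :=
      ⟨hwj.1, (𝒞.lower_mono (by lia)).trans_lt hwk.2.1, hwj.2.2.trans_le (𝒞.upper_mono hle)⟩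
    rw [ih ⟨by have := hj.1; lia, by have := hk.2; lia⟩ hk']
    exact (hH k ⟨by have := hj.1; lia, by have := hk.2; lia⟩ w ⟨hwk.1, hwk.2.1, hk'.2.2⟩).symm

/-! ### From strips back to sectors -/

/-- The branch of the logarithm with imaginary part in `(a, a + 2π]`. -/
noncomputable def branchLog (a : ℝ) (z : ℂ) : ℂ :=
  Complex.log (z * Complex.exp (-((a + Real.pi : ℝ) * Complex.I))) + (a + Real.pi : ℝ) * Complex.I

lemma exp_branchLog (a : ℝ) {z : ℂ} (hz : z ≠ 0) : Complex.exp (branchLog a z) = z := by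
  rw [branchLog, Complex.exp_add, Complex.exp_log (mul_ne_zero hz (Complex.exp_ne_zero _)),
    mul_assoc, ← Complex.exp_add, neg_add_cancel, Complex.exp_zero, mul_one]

lemma branchLog_exp {a : ℝ} {w : ℂ} (h : w.im ∈ Ioo a (a + 2 * Real.pi)) :
    branchLog a (Complex.exp w) = w := by
  rw [branchLog, ← Complex.exp_add, Complex.log_exp]
  · ring
  · simp; linarith [h.1]
  · simp; linarith [h.2]

lemma differentiableAt_branchLog {a : ℝ} {w : ℂ} (h : w.im ∈ Ioo a (a + 2 * Real.pi)) :
    DifferentiableAt ℂ (branchLog a) (Complex.exp w) := by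
  refine DifferentiableAt.add_const _ (DifferentiableAt.clog (by fun_prop) ?_)
  have h1 := h.1
  have h2 := h.2
  rw [← Complex.exp_add, Complex.mem_slitPlane_iff_arg]
  refine ⟨?_, Complex.exp_ne_zero _⟩
  rw [← Complex.log_im, Complex.log_exp]
  · simp; intro h3; linarith
  · simp; linarith
  · simp; linarith

lemma mem_sector_iff {a b r : ℝ} (hr : 0 < r) {z : ℂ} :
    z ∈ sector a b r ↔ ∃ w ∈ logStrip a b (Real.log r), Complex.exp w = z := by
  constructor
  · rintro ⟨ρ, θ, h1, h2, h3, h4, rfl⟩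
    refine ⟨Real.log ρ + θ * Complex.I,
      ofReal_add_mul_I_mem_logStrip (Real.log_lt_log h1 h2) ⟨h3, h4⟩, ?_⟩
    rw [Complex.exp_add, ← Complex.ofReal_exp, Real.exp_log h1]
  · rintro ⟨w, ⟨h1, h2, h3⟩, rfl⟩
    refine ⟨Real.exp w.re, w.im, Real.exp_pos _, (Real.lt_log_iff_exp_lt hr).1 h1, h2, h3, ?_⟩
    rw [Complex.ofReal_exp, ← Complex.exp_add, Complex.re_add_im]

lemma isOpen_sector {a b r : ℝ} (hr : 0 < r) : IsOpen (sector a b r) := by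
  have : sector a b r = Complex.exp '' logStrip a b (Real.log r) := by
    ext z
    rw [mem_sector_iff hr]
    rfl
  rw [this]
  exact Complex.isOpenMap_exp _ (isOpen_logStrip _ _ _)

lemma exp_mem_sector {a b r : ℝ} (hr : 0 < r) {w : ℂ} (hw : w ∈ logStrip a b (Real.log r)) :
    Complex.exp w ∈ sector a b r :=
  (mem_sector_iff hr).2 ⟨w, hw, rfl⟩

lemma ne_zero_of_mem_sector {a b r : ℝ} (hr : 0 < r) {z : ℂ} (hz : z ∈ sector a b r) : z ≠ 0 := by
  obtain ⟨w, -, rfl⟩ := (mem_sector_iff hr).1 hz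
  exact Complex.exp_ne_zero _

lemma branchLog_mem_logStrip {a b r : ℝ} (hr : 0 < r) (hab : b ≤ a + 2 * Real.pi) {z : ℂ}
    (hz : z ∈ sector a b r) : branchLog a z ∈ logStrip a b (Real.log r) := by
  obtain ⟨w, hw, rfl⟩ := (mem_sector_iff hr).1 hz
  rwa [branchLog_exp ⟨hw.2.1, hw.2.2.trans_le hab⟩]

lemma differentiableOn_branchLog {a b r : ℝ} (hr : 0 < r) (hab : b ≤ a + 2 * Real.pi) :
    DifferentiableOn ℂ (branchLog a) (sector a b r) := by
  intro z hz
  obtain ⟨w, hw, rfl⟩ := (mem_sector_iff hr).1 hz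
  exact (differentiableAt_branchLog ⟨hw.2.1, hw.2.2.trans_le hab⟩).differentiableWithinAt

/-- The closure contains points of modulus `r'`. The strict inequality puts a proper subsector into
a strip cut off before `log r`, where the uniform expansion holds; the lateral sides need no such
care. -/
lemma radius_lt_of_closure_subset {a b r a' b' r' : ℝ} (hab' : a' < b') (hr' : 0 < r')
    (h : closure (sector a' b' r') \ {0} ⊆ sector a b r) : r' < r := by
  obtain ⟨θ, hθ⟩ := exists_between hab'
  have hmem : (r' * Complex.exp (θ * Complex.I) : ℂ) ∈ closure (sector a' b' r') := by
    have ht : Tendsto (fun x : ℝ => (x * Complex.exp (θ * Complex.I) : ℂ)) (𝓝[<] r')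
        (𝓝 (r' * Complex.exp (θ * Complex.I))) :=
      (Continuous.tendsto (by fun_prop) r').mono_left nhdsWithin_le_nhds
    refine mem_closure_of_tendsto ht ?_
    filter_upwards [Ioo_mem_nhdsLT hr'] with x hx
    exact ⟨x, θ, hx.1, hx.2, hθ.1, hθ.2, rfl⟩
  have hne : (r' * Complex.exp (θ * Complex.I) : ℂ) ≠ 0 :=
    mul_ne_zero (by exact_mod_cast hr'.ne') (Complex.exp_ne_zero _)
  obtain ⟨ρ, φ', h1, h2, -, -, h3⟩ := h ⟨hmem, hne⟩
  have := congrArg norm h3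
  rw [norm_mul, norm_mul, Complex.norm_exp_ofReal_mul_I, Complex.norm_exp_ofReal_mul_I,
    Complex.norm_real, Complex.norm_real, mul_one, mul_one, Real.norm_of_nonneg hr'.le,
    Real.norm_of_nonneg h1.le] at this
  linarith

lemma HasAsymptoticExpansion.congr {M : ℕ → ℝ} {f g : ℂ → E} {c : ℕ → E} {S : Set ℂ}
    (h : HasAsymptoticExpansion M f c S) (hfg : ∀ z ∈ S, g z = f z) :
    HasAsymptoticExpansion M g c S := by
  refine ⟨h.1.congr hfg, fun a b r hab hab' hr hsub => ?_⟩
  obtain ⟨C, A, hC, hA, hb⟩ := h.2 a b r hab hab' hr hsub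
  refine ⟨C, A, hC, hA, fun n hn z hz => ?_⟩
  rw [hfg z (hsub ⟨subset_closure hz, ne_zero_of_mem_sector hr hz⟩)]
  exact hb n hn z hz

/-- Uniform expansions in the logarithmic coordinate are asymptotic expansions. -/
lemma hasAsymptoticExpansion_of_unifExp {M : ℕ → ℝ} {H : ℂ → E} {c : ℕ → E} {a b r : ℝ}
    (hr : 0 < r) (hab : b ≤ a + 2 * Real.pi)
    (hH : DifferentiableOn ℂ H (logStrip a b (Real.log r)))
    (hu : ∀ L < Real.log r, UnifExp M c H (logStrip a b L)) :
    HasAsymptoticExpansion M (fun z => H (branchLog a z)) c (sector a b r) := by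
  refine ⟨hH.comp (differentiableOn_branchLog hr hab)
    fun z hz => branchLog_mem_logStrip hr hab hz, fun a' b' r' h1 h2 hr' hsub => ?_⟩
  have hlt := radius_lt_of_closure_subset h1 hr' hsub
  obtain ⟨C, A, hC, hA, hb⟩ := hu (Real.log r') (Real.log_lt_log hr' hlt)
  refine ⟨C, A, hC, hA, fun n _ z hz => ?_⟩
  have hne := ne_zero_of_mem_sector hr' hz
  have hw := branchLog_mem_logStrip hr hab (hsub ⟨subset_closure hz, hne⟩)
  have he := exp_branchLog a hne
  have hnorm : ‖z‖ = Real.exp (branchLog a z).re := by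
    rw [← Complex.norm_exp, he]
  have hre : (branchLog a z).re < Real.log r' := by
    obtain ⟨v, hv, hvz⟩ := (mem_sector_iff hr').1 hz
    rw [Real.lt_log_iff_exp_lt hr', ← hnorm, ← hvz, Complex.norm_exp,
      ← Real.lt_log_iff_exp_lt hr']
    exact hv.1
  have := hb n _ ⟨hre, hw.2⟩
  simpa only [Complex.exp_nat_mul, he, Real.exp_nat_mul, ← hnorm] using this

/-! ### Convergent series and sources of flatness -/

lemma UnifExp.exists_norm_le {m : ℕ → ℝ} {a : ℕ → E} {f : ℂ → E} {W : Set ℂ}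
    (h : UnifExp m a f W) : ∃ B, ∀ w ∈ W, ‖f w‖ ≤ B := by
  obtain ⟨C, A, hC, hA, h⟩ := h
  exact ⟨C * m 0, fun w hw => by simpa using h 0 w hw⟩

/-- Convergent power series are uniform expansions. -/
lemma unifExp_of_hasSum {m : ℕ → ℝ} (hm : ∀ n, 1 ≤ m n) {a : ℕ → E} {f : ℂ → E}
    {r : ℝ} (hr : 0 < r) (h : ∀ z ∈ Metric.ball (0 : ℂ) r, HasSum (fun n => z ^ n • a n) (f z))
    {L : ℝ} (hL : L < Real.log r) :
    UnifExp m a (fun w => f (Complex.exp w)) {w | w.re < L} := by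
  -- The terms are bounded at modulus `exp L'`, so for `Re w < L` the tail is dominated by a
  -- geometric series of ratio `exp (L - L')`.
  obtain ⟨L', h1, h2⟩ := exists_between hL
  have hball : ∀ x : ℝ, x < Real.log r → ∀ w : ℂ, w.re ≤ x →
      Complex.exp w ∈ Metric.ball (0 : ℂ) r := fun x hx w hw => by
    rw [mem_ball_zero_iff, Complex.norm_exp, ← Real.lt_log_iff_exp_lt hr]
    linarith
  obtain ⟨B, hB⟩ : ∃ B, ∀ n, ‖Complex.exp L' ^ n • a n‖ ≤ B := by
    have hs := (h (Complex.exp L') (hball L' h2 _ (by simp))).summable.tendsto_atTop_zero.norm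
    obtain ⟨B, hB⟩ := hs.bddAbove_range
    exact ⟨B, fun n => hB ⟨n, rfl⟩⟩
  have hB0 : 0 ≤ B := (norm_nonneg _).trans (hB 0)
  have hq : Real.exp (L - L') < 1 := by
    rw [Real.exp_lt_one_iff]
    linarith
  have hq' : 0 < 1 - Real.exp (L - L') := by linarith
  refine ⟨(B + 1) / (1 - Real.exp (L - L')), Real.exp (-L'), by positivity, Real.exp_pos _,
    fun n w hw => ?_⟩
  have hs := h _ (hball L hL w (le_of_lt hw))
  have hsn := (hasSum_nat_add_iff' n).2 hs
  have hterm : ∀ k : ℕ, ‖Complex.exp w ^ (k + n) • a (k + n)‖ ≤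
      B * Real.exp (n * (w.re - L')) * Real.exp (L - L') ^ k := fun k => by
    have e : Complex.exp w ^ (k + n) • a (k + n) =
        Complex.exp (w - L') ^ (k + n) • Complex.exp L' ^ (k + n) • a (k + n) := by
      rw [smul_smul, ← mul_pow, ← Complex.exp_add, sub_add_cancel]
    rw [e, norm_smul, norm_pow, Complex.norm_exp, pow_add, ← Real.exp_nat_mul _ n]
    have hre : (w - L' : ℂ).re = w.re - L' := by simp
    rw [hre]
    calc _ ≤ Real.exp (L - L') ^ k * Real.exp (n * (w.re - L')) * B := by
          gcongr
          · exact le_of_lt hw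
          · exact hB _
      _ = _ := by ring
  have hgeo := (hasSum_geometric_of_lt_one (Real.exp_pos _).le hq).mul_left
    (B * Real.exp (n * (w.re - L')))
  have hle := tsum_of_norm_bounded hgeo hterm
  rw [hsn.tsum_eq] at hle
  simp only [Complex.exp_nat_mul]
  refine hle.trans ?_
  have e2 : Real.exp (n * (w.re - L')) = Real.exp (-L') ^ n * Real.exp (n * w.re) := by
    rw [← Real.exp_nat_mul, ← Real.exp_add]
    ring_nf
  rw [e2, ← div_eq_mul_inv, mul_div_right_comm]
  calc _ ≤ (B + 1) / (1 - Real.exp (L - L')) * (Real.exp (-L') ^ n * Real.exp (n * w.re)) := by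
        gcongr
        linarith
    _ = (B + 1) / (1 - Real.exp (L - L')) * Real.exp (-L') ^ n * 1 * Real.exp (n * w.re) := by
        ring
    _ ≤ _ := by
        gcongr
        exact hm n

omit [NormedSpace ℂ E] in
lemma isFlat_zero {m : ℕ → ℝ} (hm : ∀ n, 0 ≤ m n) {D : ℂ → E} {W : Set ℂ} (hD : ∀ w ∈ W, D w = 0) :
    IsFlat m D W := by
  refine ⟨1, 1, one_pos, one_pos, fun n w hw => ?_⟩
  have := hm n
  rw [hD w hw, norm_zero]
  positivity

omit [NormedSpace ℂ E] in
-- The infimum is bounded by its term of index `n + 1`, which supplies the spare factor `exp (Re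
-- w)`; moderate growth then brings `M (n + 1)` back to `M n`.
lemma isFlat_of_hFun {M : ℕ → ℝ} (hM : StronglyRegular M) {D : ℂ → E} {W : Set ℂ} {K B : ℝ}
    (hK : 0 < K) (hB : 0 < B) (h : ∀ w ∈ W, ‖D w‖ ≤ K * hFun M (B * Real.exp w.re)) :
    IsFlat M D W := by
  obtain ⟨A, hA, hg⟩ := hM.moderate_growth
  have h1 := hM.pos 1
  refine ⟨K * A * B * M 1, A * B, by positivity, by positivity, fun n w hw => ?_⟩
  have hn := hM.pos n
  have hbdd : BddBelow (range fun p : ℕ => M p * (B * Real.exp w.re) ^ p) :=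
    ⟨0, by
      rintro _ ⟨p, rfl⟩
      have := hM.pos p
      positivity⟩
  calc ‖D w‖ ≤ K * hFun M (B * Real.exp w.re) := h w hw
    _ ≤ K * (M (n + 1) * (B * Real.exp w.re) ^ (n + 1)) := by
        gcongr
        exact ciInf_le hbdd (n + 1)
    _ ≤ K * (A ^ (n + 1) * M n * M 1 * (B * Real.exp w.re) ^ (n + 1)) := by
        gcongr
        exact hg n 1
    _ = _ := by
        rw [Real.exp_nat_mul, mul_pow, mul_pow]
        ring

lemma one_le_gevrey {α : ℝ} (hα : 0 < α) (n : ℕ) : 1 ≤ gevrey α n :=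
  Real.one_le_rpow (by exact_mod_cast Nat.one_le_iff_ne_zero.2 (Nat.factorial_ne_zero n))
    (by positivity)

lemma gevrey_succ_le {α : ℝ} (hα : 0 < α) (n : ℕ) :
    gevrey α (n + 1) ≤ ((2 : ℝ) ^ (1 / α)) ^ n * gevrey α n := by
  have h2 : ((n + 1 : ℕ) : ℝ) ≤ (2 : ℝ) ^ n := by exact_mod_cast Nat.lt_two_pow_self
  rw [gevrey, gevrey, Nat.factorial_succ, Nat.cast_mul, Real.mul_rpow (by positivity)
    (by positivity), ← Real.rpow_natCast, ← Real.rpow_mul (by norm_num), mul_comm (1 / α),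
    Real.rpow_mul (by norm_num), Real.rpow_natCast]
  gcongr

/-- Take `y ^ n / n! ≤ exp y` with `y = B α / t ^ α`, invert it, and raise it to the power `1 / α`.
-/
lemma exp_neg_div_rpow_le {α B t : ℝ} (hα : 0 < α) (hB : 0 < B) (ht : 0 < t) (n : ℕ) :
    Real.exp (-B / t ^ α) ≤ gevrey α n * (((B * α)⁻¹) ^ (1 / α) * t) ^ n := by
  have hy : 0 < B * α / t ^ α := by positivity
  have h1 := Real.pow_div_factorial_le_exp _ hy.le n
  have hf : (0 : ℝ) < (n ! : ℕ) := by exact_mod_cast Nat.factorial_pos n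
  have h2 : Real.exp (-(B * α / t ^ α)) ≤ (n ! : ℕ) * ((B * α)⁻¹ * t ^ α) ^ n := by
    rw [Real.exp_neg]
    calc _ ≤ ((B * α / t ^ α) ^ n / (n ! : ℕ))⁻¹ := inv_anti₀ (by positivity) h1
      _ = _ := by
        rw [inv_div, div_eq_mul_inv, ← inv_pow, inv_div, div_eq_mul_inv, mul_comm (t ^ α)]
  have h3 := Real.rpow_le_rpow (Real.exp_pos _).le h2 (show 0 ≤ 1 / α by positivity)
  rw [← Real.exp_mul, Real.mul_rpow hf.le (by positivity)] at h3
  have e1 : -(B * α / t ^ α) * (1 / α) = -B / t ^ α := by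
    field_simp
  have e2 : (((B * α)⁻¹ * t ^ α) ^ n) ^ (1 / α) = (((B * α)⁻¹) ^ (1 / α) * t) ^ n := by
    rw [← Real.rpow_natCast, ← Real.rpow_mul (by positivity), mul_comm (n : ℝ),
      Real.rpow_mul (by positivity), Real.rpow_natCast, Real.mul_rpow (by positivity)
      (by positivity), ← Real.rpow_mul ht.le, mul_one_div_cancel hα.ne', Real.rpow_one]
  rwa [e1, e2] at h3

omit [NormedSpace ℂ E] in
lemma isFlat_of_exp {α : ℝ} (hα : 0 < α) {D : ℂ → E} {W : Set ℂ} {K B : ℝ}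
    (hK : 0 < K) (hB : 0 < B) (h : ∀ w ∈ W, ‖D w‖ ≤ K * Real.exp (-B / Real.exp w.re ^ α)) :
    IsFlat (gevrey α) D W := by
  obtain ⟨b, hb⟩ : ∃ b, b = ((B * α)⁻¹) ^ (1 / α) := ⟨_, rfl⟩
  have hb0 : 0 < b := by rw [hb]; positivity
  refine ⟨K * b, (2 : ℝ) ^ (1 / α) * b, by positivity, by positivity, fun n w hw => ?_⟩
  calc ‖D w‖ ≤ K * Real.exp (-B / Real.exp w.re ^ α) := h w hw
    _ ≤ K * (gevrey α (n + 1) * (b * Real.exp w.re) ^ (n + 1)) := by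
        rw [hb]
        gcongr
        exact exp_neg_div_rpow_le hα hB (Real.exp_pos _) _
    _ ≤ K * ((((2 : ℝ) ^ (1 / α)) ^ n * gevrey α n) * (b * Real.exp w.re) ^ (n + 1)) := by
        gcongr
        exact gevrey_succ_le hα n
    _ = _ := by
        rw [Real.exp_nat_mul, mul_pow, mul_pow]
        ring

/-! ### Descent to the punctured disc and gluing -/

section

variable {ν : ℕ} (𝒞 : GoodCovering ν)

lemma mem_strip_of_exp_eq {L : ℝ} {k : ℤ} {w v : ℂ} (hv : v ∈ 𝒞.strip k L)
    (h : Complex.exp w = Complex.exp v) :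
    ∃ q : ℤ, w = v + q * (2 * Real.pi * Complex.I) ∧ w ∈ 𝒞.strip (k + q * ν) L := by
  obtain ⟨q, rfl⟩ := Complex.exp_eq_exp_iff_exists_int.1 h
  refine ⟨q, rfl, by simpa using hv.1, ?_, ?_⟩
  · rw [𝒞.lower_add_mul_period]
    simpa using hv.2.1
  · rw [𝒞.upper_add_mul_period]
    simpa using hv.2.2

/-- Compatible functions on the strips descend to the punctured disc. -/
lemma exists_descent {X : Type*} [Nonempty X] {L : ℝ} {H : ℤ → ℂ → X}
    (hH : ∀ k, ∀ w ∈ 𝒞.overlapStrip k L, H (k + 1) w = H k w)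
    (hper : ∀ k w, H (k + ν) (w + 2 * Real.pi * Complex.I) = H k w) :
    ∃ A : ℂ → X, ∀ k, ∀ w ∈ 𝒞.strip k L, A (Complex.exp w) = H k w := by
  have hwd : ∀ (j k : ℤ) (w v : ℂ), w ∈ 𝒞.strip j L → v ∈ 𝒞.strip k L →
      Complex.exp w = Complex.exp v → H j w = H k v := fun j k w v hw hv h => by
    obtain ⟨q, hq, hw'⟩ := mem_strip_of_exp_eq 𝒞 hv h
    -- Two logarithms of one point differ by `q` periods; after shifting the index `k` by `q * ν`,
    -- the same point lies in both strips.
    rw [eqOn_strip_inter 𝒞 (p := min j (k + q * ν)) (q := max j (k + q * ν))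
      (fun k _ => hH k) ⟨min_le_left _ _, le_max_left _ _⟩ ⟨min_le_right _ _, le_max_right _ _⟩
      hw hw', hq, apply_add_mul_period hper]
  have hex : ∀ z : ℂ, ∃ x : X, ∀ k, ∀ w ∈ 𝒞.strip k L, Complex.exp w = z → x = H k w := by
    intro z
    by_cases h : ∃ k, ∃ w ∈ 𝒞.strip k L, Complex.exp w = z
    · obtain ⟨k, w, hw, rfl⟩ := h
      exact ⟨H k w, fun j v hv hvw => hwd k j w v hw hv hvw.symm⟩
    · push Not at h
      exact ⟨Classical.arbitrary X, fun k w hw hwz => absurd hwz (h k w hw)⟩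
  choose A hA using hex
  exact ⟨A, fun k w hw => hA _ k w hw rfl⟩

lemma branchLog_mem_strip {k : ℤ} {z : ℂ} (hz : z ∈ 𝒞.𝓔 k) :
    branchLog (𝒞.lower k) z ∈ 𝒞.strip k (Real.log 𝒞.radius) :=
  branchLog_mem_logStrip 𝒞.radius_pos (𝒞.upper_le k) hz

lemma ne_zero_of_mem_sector' {k : ℤ} {z : ℂ} (hz : z ∈ 𝒞.𝓔 k) : z ≠ 0 :=
  ne_zero_of_mem_sector 𝒞.radius_pos hz

lemma exp_mem_of_mem_strip {k : ℤ} {w : ℂ} (hw : w ∈ 𝒞.strip k (Real.log 𝒞.radius)) :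
    Complex.exp w ∈ 𝒞.𝓔 k :=
  exp_mem_sector 𝒞.radius_pos hw

/-- For `j = k + q * ν` the branches of the logarithm differ by `2πi q`, which the periodicity of
`H` absorbs. So the functions on sectors depend only on the index modulo `ν`. -/
lemma apply_branchLog_congr {X : Type*} {H : ℤ → ℂ → X}
    (hper : ∀ k w, H (k + ν) (w + 2 * Real.pi * Complex.I) = H k w) {j k : ℤ}
    (hjk : (j : ZMod ν) = k) {z : ℂ} (hz : z ∈ 𝒞.𝓔 k) :
    H j (branchLog (𝒞.lower j) z) = H k (branchLog (𝒞.lower k) z) := by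
  obtain ⟨q, hq⟩ := (ZMod.intCast_eq_intCast_iff_dvd_sub k j ν).1 hjk.symm
  obtain rfl : j = k + q * ν := by linear_combination hq
  have hw := branchLog_mem_strip 𝒞 hz
  set w := branchLog (𝒞.lower k) z with hwdef
  have hz0 := ne_zero_of_mem_sector' 𝒞 hz
  have he : Complex.exp (w + q * (2 * Real.pi * Complex.I)) = z := by
    rw [← exp_branchLog (𝒞.lower k) hz0, ← hwdef, Complex.exp_eq_exp_iff_exists_int]
    exact ⟨q, rfl⟩
  rw [← apply_add_mul_period hper k q w]
  congr 1
  conv_lhs => rw [← he]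
  refine branchLog_exp ?_
  rw [𝒞.lower_add_mul_period]
  have h1 := hw.2.1
  have h2 := hw.2.2.trans_le (𝒞.upper_le k)
  constructor
  · simp; linarith
  · simp; linarith

/-- A function on the punctured disc which is holomorphic on every sector of a good covering and
bounded near the origin on each of them extends to the disc. -/
lemma exists_extension_of_bounded [CompleteSpace E] {f : ℂ → E}
    (hd : ∀ k, DifferentiableOn ℂ f (𝒞.𝓔 k))
    (hb : ∀ k, ∃ C ρ : ℝ, 0 < ρ ∧ ∀ z ∈ 𝒞.𝓔 k, ‖z‖ < ρ → ‖f z‖ ≤ C) :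
    ∃ g : ℂ → E, DifferentiableOn ℂ g (Metric.ball 0 𝒞.radius) ∧ ∀ z, z ≠ 0 → g z = f z := by
  have hfd : DifferentiableOn ℂ f (Metric.ball 0 𝒞.radius \ {0}) := fun z hz => by
    rw [← 𝒞.iUnion_eq] at hz
    obtain ⟨k, hk⟩ := mem_iUnion.1 hz
    exact ((hd k).differentiableAt
      ((isOpen_sector 𝒞.radius_pos).mem_nhds hk)).differentiableWithinAt
  choose C ρ hρ hC using hb
  have hbd : ∀ᶠ z in 𝓝[≠] (0 : ℂ), ‖f z - f 0‖ ≤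
      ∑ k ∈ Finset.range ν, |C k| + ‖f 0‖ := by
    have h1 : ∀ᶠ z : ℂ in 𝓝[≠] (0 : ℂ), ∀ k ∈ Finset.range ν, ‖z‖ < ρ k := by
      rw [Filter.eventually_all_finset]
      intro k _
      refine nhdsWithin_le_nhds ?_
      filter_upwards [Metric.ball_mem_nhds (0 : ℂ) (hρ k)] with z hz
      simpa using hz
    have h2 : ∀ᶠ z : ℂ in 𝓝[≠] (0 : ℂ), z ∈ Metric.ball 0 𝒞.radius \ {0} := by
      filter_upwards [nhdsWithin_le_nhds (Metric.ball_mem_nhds (0 : ℂ) 𝒞.radius_pos),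
        self_mem_nhdsWithin] with z h1 h2 using ⟨h1, h2⟩
    filter_upwards [h1, h2] with z hz1 hz2
    rw [← 𝒞.iUnion_eq] at hz2
    obtain ⟨k, hk⟩ := mem_iUnion.1 hz2
    -- The bounds come one per integer index; reducing the index modulo `ν` leaves finitely many of
    -- them.
    have hν : (0 : ℤ) < ν := by exact_mod_cast 𝒞.period_pos
    obtain ⟨l, hl⟩ := Int.eq_ofNat_of_zero_le (Int.emod_nonneg k hν.ne')
    have hlν : l < ν := by
      have := Int.emod_lt_of_pos k hν
      lia
    have hk' : z ∈ 𝒞.𝓔 l := by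
      have e1 := 𝒞.lower_add_mul_period (k % ν) (k / ν)
      have e2 := 𝒞.upper_add_mul_period (k % ν) (k / ν)
      rw [Int.emod_add_ediv_mul, hl] at e1 e2
      obtain ⟨w, hw, rfl⟩ := (mem_sector_iff 𝒞.radius_pos).1 hk
      rw [e1, e2] at hw
      refine (mem_sector_iff 𝒞.radius_pos).2
        ⟨w + (-(k / ν) : ℤ) * (2 * Real.pi * Complex.I), ⟨by simpa using hw.1, ?_, ?_⟩, ?_⟩
      · have := hw.2.1
        simp; linarith
      · have := hw.2.2
        simp; linarith
      · rw [Complex.exp_eq_exp_iff_exists_int]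
        exact ⟨_, rfl⟩
    calc ‖f z - f 0‖ ≤ ‖f z‖ + ‖f 0‖ := norm_sub_le _ _
      _ ≤ |C l| + ‖f 0‖ := by
          gcongr
          exact (hC l z hk' (hz1 l (Finset.mem_range.2 hlν))).trans (le_abs_self _)
      _ ≤ _ := by
          gcongr
          exact Finset.single_le_sum (f := fun k : ℕ => |C k|) (fun _ _ => abs_nonneg _)
            (Finset.mem_range.2 hlν)
  refine ⟨_, Complex.differentiableOn_update_limUnder_of_isLittleO
    (Metric.ball_mem_nhds 0 𝒞.radius_pos) hfd
    (IsBoundedUnder.isLittleO_sub_self_inv ⟨_, eventually_map.2 hbd⟩), fun z hz => ?_⟩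
  exact Function.update_of_ne hz _ _

/-- Functions on consecutive strips which agree on the overlaps, and have a common expansion, glue
to a function on any strip which they cover. -/
lemma exists_glue {m : ℕ → ℝ} (hm : ∀ n, 0 ≤ m n) {c : ℕ → E} {H : ℤ → ℂ → E}
    {L s t : ℝ} {p q : ℤ}
    (hd : ∀ k, DifferentiableOn ℂ (H k) (𝒞.strip k L))
    (hu : ∀ k, ∀ L' < L, UnifExp m c (H k) (𝒞.strip k L'))
    (hH : ∀ k ∈ Ico p q, ∀ w ∈ 𝒞.overlapStrip k L, H (k + 1) w = H k w)
    (hst : Ioo s t ⊆ ⋃ k ∈ Icc p q, Ioo (𝒞.lower k) (𝒞.upper k)) :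
    ∃ F : ℂ → E, DifferentiableOn ℂ F (logStrip s t L) ∧
      (∀ L' < L, UnifExp m c F (logStrip s t L')) ∧
      ∀ k ∈ Icc p q, ∀ w ∈ 𝒞.strip k L, F w = H k w := by
  have hex : ∀ w : ℂ, ∃ x : E, ∀ k ∈ Icc p q, w ∈ 𝒞.strip k L → x = H k w := by
    intro w
    by_cases h : ∃ k ∈ Icc p q, w ∈ 𝒞.strip k L
    · obtain ⟨k, hk, hw⟩ := h
      exact ⟨H k w, fun j hj hwj => eqOn_strip_inter 𝒞 hH hk hj hw hwj⟩
    · push Not at h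
      exact ⟨0, fun k hk hw => absurd hw (h k hk)⟩
  choose F hF using hex
  have hcov : ∀ M, ∀ w ∈ logStrip s t M, ∃ k ∈ Icc p q, w ∈ 𝒞.strip k M := fun M w hw => by
    obtain ⟨k, hk, hwk⟩ := mem_iUnion₂.1 (hst hw.2)
    exact ⟨k, hk, hw.1, hwk⟩
  refine ⟨F, fun w hw => ?_, fun L' hL' => ?_, fun k hk w hw => hF w k hk hw⟩
  · obtain ⟨k, hk, hwk⟩ := hcov L w hw
    have hn : 𝒞.strip k L ∈ 𝓝 w := (isOpen_logStrip _ _ _).mem_nhds hwk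
    refine DifferentiableAt.differentiableWithinAt
      (((hd k).differentiableAt hn).congr_of_eventuallyEq ?_)
    filter_upwards [hn] with v hv using hF v k hk hv
  · refine (UnifExp.biUnion hm (Finset.Icc p q) (V := fun k => 𝒞.strip k L') fun k hk =>
      (hu k L' hL').congr fun w hw =>
        hF w k (Finset.mem_Icc.1 hk) ⟨hw.1.trans hL', hw.2⟩).mono fun w hw => ?_
    obtain ⟨k, hk, hwk⟩ := hcov L' w hw
    exact mem_iUnion₂.2 ⟨k, Finset.mem_Icc.2 hk, hwk⟩

end

/-! ### The decomposition and the summability statement -/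

/-- The cocycle is cut into two truncated cocycles, each split in its own class of flatness. The
functions stay on strips indexed by `ℤ`, because summability later rests on the absence of jumps of
`H₁` over `I₂`. -/
lemma exists_decomposition {E : Type*} [NormedAddCommGroup E] [NormedSpace ℂ E] [CompleteSpace E]
    {ν : ℕ} (𝒞 : GoodCovering ν) {M : ℕ → ℝ} (hM : StronglyRegular M) {G : ZMod ν → ℂ → E}
    (hG : ∀ i : ℤ, DifferentiableOn ℂ (G i) (𝒞.𝓔 i))
    (hGbdd : ∀ i : ℤ, ∃ C ρ : ℝ, 0 < ρ ∧ ∀ ε ∈ 𝒞.𝓔 i, ‖ε‖ < ρ → ‖G i ε‖ ≤ C)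
    {α : ℝ} (hα : 0 < α) {I₁ I₂ : Set (ZMod ν)} (hunion : I₁ ∪ I₂ = Set.univ)
    (hinter : I₁ ∩ I₂ = ∅)
    (hΔ₁ : ∀ i : ℤ, (i : ZMod ν) ∈ I₁ → ∃ K₁ M₁ : ℝ, 0 < K₁ ∧ 0 < M₁ ∧
      ∀ ε ∈ 𝒞.𝓔 i ∩ 𝒞.𝓔 (i + 1),
        ‖G ((i + 1 : ℤ) : ZMod ν) ε - G i ε‖ ≤ K₁ * Real.exp (-M₁ / ‖ε‖ ^ α))
    (hΔ₂ : ∀ i : ℤ, (i : ZMod ν) ∈ I₂ → ∃ K₂ M₂ : ℝ, 0 < K₂ ∧ 0 < M₂ ∧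
      ∀ ε ∈ 𝒞.𝓔 i ∩ 𝒞.𝓔 (i + 1),
        ‖G ((i + 1 : ℤ) : ZMod ν) ε - G i ε‖ ≤ K₂ * hFun M (M₂ * ‖ε‖)) :
    ∃ (c c₁ c₂ : ℕ → E) (f : ℂ → E) (H₁ H₂ : ℤ → ℂ → E),
      (∀ ε ∈ Metric.ball (0 : ℂ) 𝒞.radius, HasSum (fun n : ℕ => ε ^ n • c n) (f ε)) ∧
      DifferentiableOn ℂ f (Metric.ball 0 𝒞.radius) ∧
      (∀ k : ℤ, ∀ w ∈ 𝒞.strip k (Real.log 𝒞.radius),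
        G k (Complex.exp w) = f (Complex.exp w) + H₁ k w + H₂ k w) ∧
      (∀ k, DifferentiableOn ℂ (H₁ k) (𝒞.strip k (Real.log 𝒞.radius))) ∧
      (∀ k, DifferentiableOn ℂ (H₂ k) (𝒞.strip k (Real.log 𝒞.radius))) ∧
      (∀ k, ∀ L < Real.log 𝒞.radius, UnifExp (gevrey α) c₁ (H₁ k) (𝒞.strip k L)) ∧
      (∀ k, ∀ L < Real.log 𝒞.radius, UnifExp M c₂ (H₂ k) (𝒞.strip k L)) ∧
      (∀ k w, H₁ (k + ν) (w + 2 * Real.pi * Complex.I) = H₁ k w) ∧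
      (∀ k w, H₂ (k + ν) (w + 2 * Real.pi * Complex.I) = H₂ k w) ∧
      ∀ k : ℤ, (k : ZMod ν) ∈ I₂ → ∀ w ∈ 𝒞.overlapStrip k (Real.log 𝒞.radius),
        H₁ (k + 1) w = H₁ k w := by
  classical
  obtain ⟨L, hL⟩ : ∃ L, L = Real.log 𝒞.radius := ⟨_, rfl⟩
  have hgev : ∀ n, 0 ≤ gevrey α n := fun n => zero_le_one.trans (one_le_gevrey hα n)
  have hM0 : ∀ n, 0 ≤ M n := fun n => (hM.pos n).le
  set Δ : ℤ → ℂ → E := fun i w =>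
    G ((i + 1 : ℤ) : ZMod ν) (Complex.exp w) - G i (Complex.exp w)
  have hov : ∀ i, ∀ w ∈ 𝒞.overlapStrip i L, w ∈ 𝒞.strip i L ∧ w ∈ 𝒞.strip (i + 1) L :=
    fun i w hw => ⟨⟨hw.1, (𝒞.lower_mono (by lia)).trans_lt hw.2.1, hw.2.2⟩,
      hw.1, hw.2.1, hw.2.2.trans_le (𝒞.upper_mono (by lia))⟩
  have hexp : ∀ i, ∀ w ∈ 𝒞.overlapStrip i L, Complex.exp w ∈ 𝒞.𝓔 i ∩ 𝒞.𝓔 (i + 1) :=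
    fun i w hw => ⟨exp_mem_of_mem_strip 𝒞 (hL ▸ (hov i w hw).1),
      exp_mem_of_mem_strip 𝒞 (hL ▸ (hov i w hw).2)⟩
  have hΔd : ∀ i, DifferentiableOn ℂ (Δ i) (𝒞.overlapStrip i L) := fun i =>
    ((hG (i + 1)).comp Complex.differentiable_exp.differentiableOn
      fun w hw => (hexp i w hw).2).sub
    ((hG i).comp Complex.differentiable_exp.differentiableOn fun w hw => (hexp i w hw).1)
  have hexpper : ∀ w : ℂ, Complex.exp (w + 2 * Real.pi * Complex.I) = Complex.exp w :=
    Complex.exp_periodic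
  have hcast : ∀ i : ℤ, ((i + ν : ℤ) : ZMod ν) = i := fun i => by simp
  have hcast' : ∀ i : ℤ, ((i + ν + 1 : ℤ) : ZMod ν) = ((i + 1 : ℤ) : ZMod ν) := fun i => by simp
  have hΔp : ∀ i w, Δ (i + ν) (w + 2 * Real.pi * Complex.I) = Δ i w := fun i w => by
    simp only [Δ, hexpper, hcast, hcast']
  -- Setting the jumps outside `I₁` to `0` preserves holomorphy and flatness, as there is no
  -- condition linking different overlaps.
  obtain ⟨c₁, H₁, hH₁d, hH₁, hH₁p, hH₁u⟩ := exists_splitting 𝒞 (L := L) hgev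
    (D := fun i w => if (i : ZMod ν) ∈ I₁ then Δ i w else 0)
    (fun i => by
      by_cases h : (i : ZMod ν) ∈ I₁
      · simpa only [if_pos h] using hΔd i
      · simpa only [if_neg h] using differentiableOn_const 0)
    (fun i => by
      by_cases h : (i : ZMod ν) ∈ I₁
      · obtain ⟨K, B, hK, hB, hb⟩ := hΔ₁ i h
        refine isFlat_of_exp hα hK hB fun w hw => ?_
        simpa only [if_pos h, Complex.norm_exp] using hb _ (hexp i w hw)
      · exact isFlat_zero hgev fun w _ => if_neg h)
    (fun i w => by simp only [hcast, hΔp])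
  obtain ⟨c₂, H₂, hH₂d, hH₂, hH₂p, hH₂u⟩ := exists_splitting 𝒞 (L := L) hM0
    (D := fun i w => if (i : ZMod ν) ∈ I₁ then 0 else Δ i w)
    (fun i => by
      by_cases h : (i : ZMod ν) ∈ I₁
      · simpa only [if_pos h] using differentiableOn_const 0
      · simpa only [if_neg h] using hΔd i)
    (fun i => by
      by_cases h : (i : ZMod ν) ∈ I₁
      · exact isFlat_zero hM0 fun w _ => if_pos h
      · have h2 : (i : ZMod ν) ∈ I₂ := by
          have := mem_univ (i : ZMod ν)
          rw [← hunion] at this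
          exact this.resolve_left h
        obtain ⟨K, B, hK, hB, hb⟩ := hΔ₂ i h2
        refine isFlat_of_hFun hM hK hB fun w hw => ?_
        simpa only [if_neg h, Complex.norm_exp] using hb _ (hexp i w hw))
    (fun i w => by simp only [hcast, hΔp])
  -- The two truncated cocycles add up to `Δ`, so subtracting both splittings removes every jump of
  -- `G`.
  obtain ⟨A, hA⟩ := exists_descent 𝒞 (L := L)
    (H := fun k w => G k (Complex.exp w) - H₁ k w - H₂ k w)
    (fun k w hw => by
      have h1 := hH₁ k w hw
      have h2 := hH₂ k w hw
      have h3 : Δ k w = (H₁ (k + 1) w - H₁ k w) + (H₂ (k + 1) w - H₂ k w) := by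
        rw [h1, h2]
        split_ifs <;> simp
      rw [← sub_eq_zero]
      have h4 : Δ k w = G ((k + 1 : ℤ) : ZMod ν) (Complex.exp w) - G k (Complex.exp w) := rfl
      rw [h4, ← sub_eq_zero] at h3
      rw [← h3]
      abel)
    (fun k w => by simp only [hexpper, hcast, hH₁p, hH₂p])
  subst hL
  have hAE : ∀ k : ℤ, ∀ z ∈ 𝒞.𝓔 k, A z =
      G k z - H₁ k (branchLog (𝒞.lower k) z) - H₂ k (branchLog (𝒞.lower k) z) := fun k z hz => by
    have := hA k _ (branchLog_mem_strip 𝒞 hz)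
    rwa [exp_branchLog _ (ne_zero_of_mem_sector' 𝒞 hz)] at this
  obtain ⟨f, hfd, hfA⟩ := exists_extension_of_bounded 𝒞 (f := A)
    (fun k => by
      have hlog := differentiableOn_branchLog 𝒞.radius_pos (𝒞.upper_le k)
      exact (((hG k).sub ((hH₁d k).comp hlog fun z hz => branchLog_mem_strip 𝒞 hz)).sub
        ((hH₂d k).comp hlog fun z hz => branchLog_mem_strip 𝒞 hz)).congr (hAE k))
    (fun k => by
      obtain ⟨C, ρ, hρ, hC⟩ := hGbdd k
      have hlt : Real.log 𝒞.radius - 1 < Real.log 𝒞.radius := by linarith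
      obtain ⟨B₁, hB₁⟩ := (hH₁u k _ hlt).exists_norm_le
      obtain ⟨B₂, hB₂⟩ := (hH₂u k _ hlt).exists_norm_le
      refine ⟨C + B₁ + B₂, min ρ (Real.exp (Real.log 𝒞.radius - 1)), lt_min hρ (Real.exp_pos _),
        fun z hz hzρ => ?_⟩
      have hw : branchLog (𝒞.lower k) z ∈ 𝒞.strip k (Real.log 𝒞.radius - 1) := by
        refine ⟨?_, (branchLog_mem_strip 𝒞 hz).2⟩
        rw [← Real.exp_lt_exp, ← Complex.norm_exp,
          exp_branchLog _ (ne_zero_of_mem_sector' 𝒞 hz)]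
        exact hzρ.trans_le (min_le_right _ _)
      rw [hAE k z hz]
      refine (norm_sub_le _ _).trans (add_le_add ((norm_sub_le _ _).trans (add_le_add ?_ ?_)) ?_)
      · exact hC z hz (hzρ.trans_le (min_le_left _ _))
      · exact hB₁ _ hw
      · exact hB₂ _ hw)
  refine ⟨fun n => (n ! : ℂ)⁻¹ • iteratedDeriv n f 0, c₁, c₂, f, H₁, H₂, fun ε hε => ?_,
    hfd, fun k w hw => ?_, hH₁d, hH₂d, hH₁u, hH₂u, hH₁p, hH₂p, fun k hk w hw => ?_⟩
  · have := Complex.hasSum_taylorSeries_on_ball hfd hε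
    simpa only [sub_zero, smul_comm (ε ^ _)] using this
  · rw [hfA _ (Complex.exp_ne_zero _), hA k w hw]
    abel
  · have hk1 : (k : ZMod ν) ∉ I₁ := fun h => by
      have : (k : ZMod ν) ∈ I₁ ∩ I₂ := ⟨h, hk⟩
      rwa [hinter] at this
    have := hH₁ k w hw
    rw [if_neg hk1] at this
    exact sub_eq_zero.1 this

end RamisSibuya

theorem mainTheorem2 {E : Type*} [NormedAddCommGroup E] [NormedSpace ℂ E] [CompleteSpace E]
    (ν : ℕ) (𝒞 : RamisSibuya.GoodCovering ν)
    (M : ℕ → ℝ) (hM : RamisSibuya.StronglyRegular M)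
    (G : ZMod ν → ℂ → E)
    (hG : ∀ i : ℤ, DifferentiableOn ℂ (G i) (𝒞.𝓔 i))
    (hGbdd : ∀ i : ℤ, ∃ C ρ : ℝ, 0 < ρ ∧ ∀ ε ∈ 𝒞.𝓔 i, ‖ε‖ < ρ → ‖G i ε‖ ≤ C)
    (α : ℝ) (hα : 0 < α)
    (I₁ I₂ : Set (ZMod ν)) (hI₁ : I₁.Nonempty) (hI₂ : I₂.Nonempty)
    (hunion : I₁ ∪ I₂ = Set.univ) (hinter : I₁ ∩ I₂ = ∅)
    (hΔ₁ : ∀ i : ℤ, (i : ZMod ν) ∈ I₁ → ∃ K₁ M₁ : ℝ, 0 < K₁ ∧ 0 < M₁ ∧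
      ∀ ε ∈ 𝒞.𝓔 i ∩ 𝒞.𝓔 (i + 1),
        ‖G ((i + 1 : ℤ) : ZMod ν) ε - G i ε‖ ≤ K₁ * Real.exp (-M₁ / ‖ε‖ ^ α))
    (hΔ₂ : ∀ i : ℤ, (i : ZMod ν) ∈ I₂ → ∃ K₂ M₂ : ℝ, 0 < K₂ ∧ 0 < M₂ ∧
      ∀ ε ∈ 𝒞.𝓔 i ∩ 𝒞.𝓔 (i + 1),
        ‖G ((i + 1 : ℤ) : ZMod ν) ε - G i ε‖ ≤ K₂ * RamisSibuya.hFun M (M₂ * ‖ε‖)) :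
    ∃ (ahat Ghat₁ Ghat₂ : ℕ → E) (a : ℂ → E) (G₁ G₂ : ZMod ν → ℂ → E),
      (∀ ε ∈ Metric.ball (0 : ℂ) 𝒞.radius, HasSum (fun n : ℕ => ε ^ n • ahat n) (a ε)) ∧
      (∀ i : ℤ, ∀ ε ∈ 𝒞.𝓔 i, G i ε = a ε + G₁ i ε + G₂ i ε) ∧
      (∀ i : ℤ,
        RamisSibuya.HasAsymptoticExpansion (RamisSibuya.gevrey α) (G₁ i) Ghat₁ (𝒞.𝓔 i)) ∧
      (∀ i : ℤ, RamisSibuya.HasAsymptoticExpansion M (G₂ i) Ghat₂ (𝒞.𝓔 i)) ∧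
      (∀ (i₀ : ℤ) (δ₁ δ₂ : ℕ) (s t : ℝ),
        (∀ k ∈ Set.Icc (i₀ - δ₁) (i₀ + δ₂), (k : ZMod ν) ∈ I₂) →
        RamisSibuya.omega M < 1 / α →
        RamisSibuya.omega M * Real.pi < 𝒞.upper i₀ - 𝒞.lower i₀ →
        Real.pi / α < t - s → t ≤ s + 2 * Real.pi →
        Set.Ioo (𝒞.lower i₀) (𝒞.upper i₀) ⊆ Set.Ioo s t →
        Set.Ioo s t ⊆ ⋃ k ∈ Set.Icc (i₀ - δ₁) (i₀ + δ₂), Set.Ioo (𝒞.lower k) (𝒞.upper k) →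
        RamisSibuya.IsMultiSumOn M α (𝒞.lower i₀) (𝒞.upper i₀) 𝒞.radius
          (fun n => ahat n + Ghat₁ n + Ghat₂ n) (G i₀)) := by
  obtain ⟨c, c₁, c₂, f, H₁, H₂, hf, hfball, hGf, hd₁, hd₂, hu₁, hu₂, hp₁, hp₂, hcomp⟩ :=
    RamisSibuya.exists_decomposition 𝒞 hM hG hGbdd hα hunion hinter hΔ₁ hΔ₂
  have hgev1 := RamisSibuya.one_le_gevrey hα
  have hgev : ∀ n, 0 ≤ RamisSibuya.gevrey α n := fun n => zero_le_one.trans (hgev1 n)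
  have hr := 𝒞.radius_pos
  -- The families sought are indexed by `ZMod ν`, while `H₁` and `H₂` are indexed by `ℤ`; an
  -- arbitrary lift is chosen, and periodicity makes the choice immaterial.
  choose rep hrep using ZMod.intCast_surjective (n := ν)
  have hrep₁ : ∀ i : ℤ, ∀ z ∈ 𝒞.𝓔 i,
      H₁ (rep i) (RamisSibuya.branchLog (𝒞.lower (rep i)) z) =
      H₁ i (RamisSibuya.branchLog (𝒞.lower i) z) := fun i z hz =>
    RamisSibuya.apply_branchLog_congr 𝒞 hp₁ (hrep i) hz
  have hrep₂ : ∀ i : ℤ, ∀ z ∈ 𝒞.𝓔 i,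
      H₂ (rep i) (RamisSibuya.branchLog (𝒞.lower (rep i)) z) =
      H₂ i (RamisSibuya.branchLog (𝒞.lower i) z) := fun i z hz =>
    RamisSibuya.apply_branchLog_congr 𝒞 hp₂ (hrep i) hz
  have hdec : ∀ i : ℤ, ∀ z ∈ 𝒞.𝓔 i, G i z = f z + H₁ i (RamisSibuya.branchLog (𝒞.lower i) z) +
      H₂ i (RamisSibuya.branchLog (𝒞.lower i) z) := fun i z hz => by
    have := hGf i _ (RamisSibuya.branchLog_mem_strip 𝒞 hz)
    rwa [RamisSibuya.exp_branchLog _ (RamisSibuya.ne_zero_of_mem_sector' 𝒞 hz)] at this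
  have hexp₂ : ∀ i : ℤ, RamisSibuya.HasAsymptoticExpansion M
      (fun z => H₂ (rep i) (RamisSibuya.branchLog (𝒞.lower (rep i)) z)) c₂ (𝒞.𝓔 i) := fun i =>
    (RamisSibuya.hasAsymptoticExpansion_of_unifExp hr (𝒞.upper_le i) (hd₂ i) (hu₂ i)).congr
      (hrep₂ i)
  refine ⟨c, c₁, c₂, f, fun i z => H₁ (rep i) (RamisSibuya.branchLog (𝒞.lower (rep i)) z),
    fun i z => H₂ (rep i) (RamisSibuya.branchLog (𝒞.lower (rep i)) z), hf, fun i z hz => ?_,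
    fun i => ?_, hexp₂, ?_⟩
  · rw [hdec i z hz, ← hrep₁ i z hz, ← hrep₂ i z hz]
  · exact (RamisSibuya.hasAsymptoticExpansion_of_unifExp hr (𝒞.upper_le i) (hd₁ i)
      (hu₁ i)).congr (hrep₁ i)
  · intro i₀ δ₁ δ₂ s t hI hω hωi hst hst' hsub hcov
    have hpi := Real.pi_pos
    have hlt : s < t := by
      have : 0 < Real.pi / α := by positivity
      linarith
    have hi₀ : i₀ ∈ Set.Icc (i₀ - δ₁) (i₀ + δ₂) := ⟨by lia, by lia⟩
    -- Gluing uses the jumps from `k` to `k + 1` inside the window, all of which have index in `I₂`.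
    obtain ⟨F, hFd, hFu, hF⟩ := RamisSibuya.exists_glue 𝒞 hgev hd₁ hu₁
      (p := i₀ - δ₁) (q := i₀ + δ₂)
      (fun k hk w hw => hcomp k (hI k ⟨hk.1, hk.2.le⟩) w hw) hcov
    have hsec : RamisSibuya.sector (𝒞.lower i₀) (𝒞.upper i₀) 𝒞.radius ⊆
        RamisSibuya.sector s t 𝒞.radius := by
      rintro z ⟨ρ, θ, h1, h2, h3, h4, rfl⟩
      have := hsub ⟨h3, h4⟩
      exact ⟨ρ, θ, h1, h2, this.1, this.2, rfl⟩
    have hfd : DifferentiableOn ℂ (fun w => f (Complex.exp w))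
        (RamisSibuya.logStrip s t (Real.log 𝒞.radius)) := by
      refine hfball.comp Complex.differentiable_exp.differentiableOn fun w hw => ?_
      rw [mem_ball_zero_iff, Complex.norm_exp, ← Real.lt_log_iff_exp_lt hr]
      exact hw.1
    -- The convergent part joins the Gevrey summand: as `1 ≤ gevrey α n`, the geometric remainder
    -- bounds of a convergent series are Gevrey bounds.
    refine ⟨hω, s, t, 𝒞.radius, hlt, hst', hr, hsec, fun n => c₁ n + c n, c₂,
      fun z => F (RamisSibuya.branchLog s z) +
        f (Complex.exp (RamisSibuya.branchLog s z)),
      fun z => H₂ (rep i₀) (RamisSibuya.branchLog (𝒞.lower (rep i₀)) z), fun n => by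
        dsimp only
        abel,
      ⟨hst, ?_⟩, ⟨hωi, hexp₂ i₀⟩, fun z hz => ?_⟩
    · exact RamisSibuya.hasAsymptoticExpansion_of_unifExp hr hst' (hFd.add hfd) fun L hL =>
        (hFu L hL).add hgev ((RamisSibuya.unifExp_of_hasSum hgev1 hr hf hL).mono fun w hw => hw.1)
    · have hw := RamisSibuya.branchLog_mem_strip 𝒞 hz
      have hz0 := RamisSibuya.ne_zero_of_mem_sector' 𝒞 hz
      -- The arguments of the sector `i₀` lie in `(s, t)`, of length at most `2π`, so both branches
      -- give the same logarithm.
      have he : RamisSibuya.branchLog s z = RamisSibuya.branchLog (𝒞.lower i₀) z := by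
        have h := hsub hw.2
        conv_lhs => rw [← RamisSibuya.exp_branchLog (𝒞.lower i₀) hz0]
        exact RamisSibuya.branchLog_exp ⟨h.1, h.2.trans_le hst'⟩
      dsimp only
      rw [hdec i₀ z hz, he, hF i₀ hi₀ _ hw, RamisSibuya.exp_branchLog _ hz0, hrep₂ i₀ z hz]
      abel
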